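/- Let $G=(V,E)$ be an infinite graph, not necessarily connected or locally finite. A ray is a one-way infinite path; an end of $G$ is a class of rays under the equivalence in which two rays are equivalent if, for every finite $T\subseteq V$, both have a tail in the same component of $G-T$. A ray in the class $\omega$ is called an $\omega$-ray. A separation of a graph with vertex set $W$ is an ordered pair $(A,B)$ with $A\cup B=W$ such that there is no edge between $A\setminus B$ and $B\setminus A$; its order is $|A\cap B|$. Let $\vec S$ be the set of all separations of $G$ of finite order and, for a cardinal $k$, let $\vec S_k\subseteq\vec S$ be the set of those of order $<k$. Give $\vec S$ the topology with the basic open sets $\{(A,B)\in\vec S : A\cap Z=A',\ B\cap Z=B'\}$, where $Z\subseteq V$ is finite and $(A',B')$ is a separation of $G[Z]$. For an end $\omega$ of $G$ let $\tau_\omega=\{(A,B)\in\vec S : \text{every } \omega\text{-ray has a tail in } B\}$, and let the cohesion of $\omega$ be $$\operatorname{coh}(\omega)=\sup\{\kappa\le\aleph_1 : \tau_\omega\cap\vec S_k \text{ is closed in } \vec S \text{ for all cardinals } k<\kappa\}.$$ Let $\deg(\omega)\in\mathbb N\cup\{\infty\}$ be the largest size (supremum of the sizes) of a family of pairwise disjoint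 $\omega$-rays. A vertex $v$ dominates $\omega$ if, for some $\omega$-ray $R$, there are infinitely many paths from $v$ to vertices of $R$ other than $v$ which are pairwise disjoint except at $v$. Let $\operatorname{dom}(\omega)\in\mathbb N\cup\{\infty\}$ be the number of vertices that dominate $\omega$. Then for every end $\omega$ of $G$: (i) $\omega$ has infinite cohesion (that is, $\operatorname{coh}(\omega)=\aleph_1$; equivalently, $\tau_\omega$ is closed in $\vec S$) if and only if $\operatorname{dom}(\omega)=\infty$. (ii) $\omega$ has unbounded cohesion (that is, $\operatorname{coh}(\omega)=\aleph_0$; equivalently, $\tau_\omega$ is not closed in $\vec S$, but $\tau_\omega\cap\vec S_k$ is for every $k\in\mathbb N$) if and only if $\deg(\omega)=\infty$ and $\operatorname{dom}(\omega)<\infty$. (iii) For every $k\in\mathbb N$, $\omega$ has bounded cohesion $\operatorname{coh}(\omega)=k$ if and only if $\deg(\omega)+\operatorname{dom}(\omega)=k-1$. -/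

import Mathlib

universe u

namespace GraphEnd

variable {V : Type u}

/-- A ray of `G`: a one-way infinite path `v₀ v₁ v₂ …`, listed from its start-vertex. -/
structure Ray (G : SimpleGraph V) where
  vert : ℕ → V
  injective : Function.Injective vert
  adj : ∀ n, G.Adj (vert n) (vert (n + 1))

/-- The vertex set of a ray. -/
def Ray.verts {G : SimpleGraph V} (R : Ray G) : Set V := Set.range R.vert

/-- `R` has a tail in the vertex set `B`. -/
def Ray.HasTailIn {G : SimpleGraph V} (R : Ray G) (B : Set V) : Prop :=
  ∃ N, ∀ n, N ≤ n → R.vert n ∈ B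

/-- Two rays are equivalent if, for every finite set `T` of vertices, both have a tail in the
same component of `G - T`. -/
def Ray.Equivalent {G : SimpleGraph V} (R R' : Ray G) : Prop :=
  ∀ T : Set V, T.Finite → ∃ C : G.ComponentCompl T,
    R.HasTailIn (C : Set V) ∧ R'.HasTailIn (C : Set V)

theorem Ray.Equivalent.refl {G : SimpleGraph V} (R : Ray G) : R.Equivalent R := by
  intro T hT
  obtain ⟨N, hN⟩ : ∃ N, ∀ n, N ≤ n → R.vert n ∉ T := by
    obtain ⟨M, hM⟩ := (hT.preimage R.injective.injOn).bddAbove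
    exact ⟨M + 1, fun n hn h => absurd (hM h) (by omega)⟩
  refine ⟨G.componentComplMk (hN N le_rfl), ?_⟩
  have key : ∀ n, N ≤ n → R.vert n ∈ (G.componentComplMk (hN N le_rfl) : Set V) := by
    intro n hn
    induction n, hn using Nat.le_induction with
    | base => exact ⟨hN N le_rfl, rfl⟩
    | succ n hn ih =>
      obtain ⟨h, e⟩ := ih
      refine ⟨hN (n + 1) (by omega), ?_⟩
      rw [← e]
      exact SimpleGraph.ConnectedComponent.eq.2 (SimpleGraph.Adj.reachable (R.adj n).symm)
  exact ⟨⟨N, key⟩, ⟨N, key⟩⟩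

theorem Ray.Equivalent.trans {G : SimpleGraph V} {R₁ R₂ R₃ : Ray G}
    (h : R₁.Equivalent R₂) (h' : R₂.Equivalent R₃) : R₁.Equivalent R₃ := by
  intro T hT
  obtain ⟨C, h₁, N, h₂⟩ := h T hT
  obtain ⟨C', ⟨N', h₂'⟩, h₃⟩ := h' T hT
  obtain ⟨_, e⟩ := h₂ (max N N') (le_max_left _ _)
  obtain ⟨_, e'⟩ := h₂' (max N N') (le_max_right _ _)
  obtain rfl : C = C' := e.symm.trans e'
  exact ⟨C, h₁, h₃⟩

/-- Equivalence of rays. -/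
instance raySetoid (G : SimpleGraph V) : Setoid (Ray G) where
  r := Ray.Equivalent
  iseqv :=
    { refl := Ray.Equivalent.refl
      symm := fun h T hT => let ⟨C, a, b⟩ := h T hT; ⟨C, b, a⟩
      trans := Ray.Equivalent.trans }

/-- The ends of `G`: the equivalence classes of its rays. -/
def Ends (G : SimpleGraph V) : Type u := Quotient (raySetoid G)

/-- `R` is an `ω`-ray, that is, it belongs to the end `ω`. -/
def Ray.BelongsTo {G : SimpleGraph V} (R : Ray G) (ω : Ends G) : Prop :=
  (Quotient.mk (raySetoid G) R : Ends G) = ω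

/-- `(A, B)` is an oriented separation of the induced subgraph `G[Z]`. For `Z = Set.univ` this is
an oriented separation of `G` itself. -/
def IsSeparation (G : SimpleGraph V) (Z A B : Set V) : Prop :=
  A ∪ B = Z ∧ ∀ a ∈ A \ B, ∀ b ∈ B \ A, ¬ G.Adj a b

/-- The oriented separations of `G` of finite order. -/
structure FinSep (G : SimpleGraph V) where
  left : Set V
  right : Set V
  isSeparation : IsSeparation G Set.univ left right
  finite : (left ∩ right).Finite

/-- The set of oriented separations `(A, B)` of finite order with `|A ∩ B| < κ`. -/
def sepsBelow (G : SimpleGraph V) (κ : Cardinal.{u}) : Set (FinSep G) :=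
  {s | Cardinal.mk (s.left ∩ s.right : Set V) < κ}

/-- The set of all `(A, B)` which induce `(A', B')` on `Z`. -/
def basicOpen (G : SimpleGraph V) (Z A' B' : Set V) : Set (FinSep G) :=
  {s | s.left ∩ Z = A' ∧ s.right ∩ Z = B'}

/-- The topology whose basic open sets are the sets of all separations inducing a given separation
of `G[Z]`, for finite sets `Z` of vertices. -/
instance finSepTopology (G : SimpleGraph V) : TopologicalSpace (FinSep G) :=
  TopologicalSpace.generateFrom
    {O | ∃ Z A' B' : Set V, Z.Finite ∧ IsSeparation G Z A' B' ∧ O = basicOpen G Z A' B'}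

/-- The end tangle induced by `ω`: all `(A, B)` of finite order such that every `ω`-ray has a tail
in `B`. -/
def endTangle {G : SimpleGraph V} (ω : Ends G) : Set (FinSep G) :=
  {s | ∀ R : Ray G, R.BelongsTo ω → R.HasTailIn s.right}

/-- The cohesion of `ω`: the supremum of all cardinals `κ ≤ ℵ₁` such that, for all cardinals
`k < κ`, the restriction of the end tangle to the separations of order `< k` is closed. -/
noncomputable def coh {G : SimpleGraph V} (ω : Ends G) : Cardinal.{u} :=
  sSup {κ | κ ≤ Cardinal.aleph 1 ∧ ∀ k < κ, IsClosed (endTangle ω ∩ sepsBelow G k)}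

/-- `ω` has infinite cohesion. -/
def HasInfiniteCohesion {G : SimpleGraph V} (ω : Ends G) : Prop := coh ω = Cardinal.aleph 1

/-- `ω` has unbounded cohesion. -/
def HasUnboundedCohesion {G : SimpleGraph V} (ω : Ends G) : Prop := coh ω = Cardinal.aleph0

/-- `ω` has bounded cohesion `k`. -/
def HasBoundedCohesion {G : SimpleGraph V} (ω : Ends G) (k : ℕ) : Prop := coh ω = k

/-- The (vertex) degree of `ω`: the largest size of a family of pairwise disjoint `ω`-rays. -/
noncomputable def deg {G : SimpleGraph V} (ω : Ends G) : ℕ∞ :=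
  sSup {n | ∃ F : Set (Ray G), (∀ R ∈ F, R.BelongsTo ω) ∧ F.PairwiseDisjoint Ray.verts ∧
    n = F.encard}

/-- The vertex `v` dominates `ω`: there are infinitely many paths, disjoint except at `v`, from `v`
to vertices other than `v` of some ray in `ω`. -/
def Dominates {G : SimpleGraph V} (v : V) (ω : Ends G) : Prop :=
  ∃ R : Ray G, R.BelongsTo ω ∧ ∃ (w : ℕ → V) (P : ∀ i, G.Path v (w i)),
    (∀ i, w i ∈ R.verts \ {v}) ∧
    ∀ i j, i ≠ j → ∀ x, x ∈ (P i).1.support → x ∈ (P j).1.support → x = v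

/-- The number of vertices which dominate `ω`. -/
noncomputable def dom {G : SimpleGraph V} (ω : Ends G) : ℕ∞ := {v : V | Dominates v ω}.encard

end GraphEnd

/-! ### Menger's theorem by augmenting linkages. -/

namespace GraphEnd

/-! The cohesion is read off from two facts: `endTangle ω` is closed iff `dom ω = ⊤`, and `endTangle
ω ∩ sepsBelow G k` is closed iff `k ≤ deg ω + dom ω`. By `isClosed_iff`, closedness means that each
separation `s` outside the set is told apart from all its members by a finite test set `Z`.

For closedness, a dominating vertex lies in the right side of every tangle separation
(`Dominates.mem_right`), and either `s` or its swap is in the tangle. If infinitely many vertices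
dominate, one outside the separator of `s` is a test set by itself. For `k = r + d`, the test set
consists of `d` dominating vertices and one late vertex from each of `r` disjoint rays: a tangle
separation agreeing with `s` there contains the `d` vertices in its separator and is crossed by the
`r` rays elsewhere, so its order is at least `k`.

Conversely, let the set `D` of dominating vertices be finite. Then `(V, D)` is not in the tangle,
but it is a limit of tangle separations of order at most `deg ω + dom ω`
(`exists_mem_endTangle_near`). After isolating `D` the end is undominated, so a finite set can be
separated from it by at most `deg ω` vertices (`Ray.exists_separates_card_le_deg`): Menger's theorem
links successive minimum separators by disjoint paths, which concatenate to disjoint rays of the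
end, one from each vertex of the first separator. -/

/-- Every list meeting `B` splits at its last element in `B`. -/
theorem exists_split_last {V : Type u} (B : Set V) (l : List V) (h : ∃ x ∈ l, x ∈ B) :
    ∃ l₁ r l₂, l = l₁ ++ r :: l₂ ∧ r ∈ B ∧ ∀ x ∈ l₂, x ∉ B := by
  induction l with
  | nil => simp at h
  | cons a l ih =>
    by_cases h' : ∃ x ∈ l, x ∈ B
    · obtain ⟨l₁, r, l₂, rfl, hr, h₂⟩ := ih h'
      exact ⟨a :: l₁, r, l₂, rfl, hr, h₂⟩
    · push Not at h'
      refine ⟨[], a, l, rfl, ?_, h'⟩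
      obtain ⟨x, hx, hB⟩ := h
      rcases List.mem_cons.1 hx with rfl | hx
      · exact hB
      · exact absurd hB (h' x hx)

/-- Every list meeting `B` splits at its first element in `B`. -/
theorem exists_split_first {V : Type u} (B : Set V) (l : List V) (h : ∃ x ∈ l, x ∈ B) :
    ∃ l₁ r l₂, l = l₁ ++ r :: l₂ ∧ r ∈ B ∧ ∀ x ∈ l₁, x ∉ B := by
  induction l with
  | nil => simp at h
  | cons a l ih =>
    by_cases ha : a ∈ B
    · exact ⟨[], a, l, rfl, ha, by simp⟩
    · obtain ⟨l₁, r, l₂, rfl, hr, h₂⟩ := ih (by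
        obtain ⟨x, hx, hB⟩ := h
        rcases List.mem_cons.1 hx with rfl | hx
        · exact absurd hB ha
        · exact ⟨x, hx, hB⟩)
      exact ⟨a :: l₁, r, l₂, rfl, hr, by simpa [ha] using h₂⟩

/-- `l` lists the vertices of a path which starts in `b`, ends in `A` and whose vertices other
than `b` avoid `B`. -/
structure IsLink {V : Type u} (G : SimpleGraph V) (A B : Set V) (b : V) (l : List V) : Prop where
  chain : l.IsChain G.Adj
  nodup : l.Nodup
  start : ∃ t, l = b :: t ∧ ∀ x ∈ t, x ∉ B
  finish : ∃ a ∈ A, l.getLast? = some a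

/-- The lists `p b`, for `b ∈ E`, are pairwise disjoint paths from `E ⊆ B` to `A`, each of which
meets `B` only in its first vertex. -/
structure IsLinkage {V : Type u} (G : SimpleGraph V) (A B E : Set V) (p : V → List V) : Prop where
  subset : E ⊆ B
  link : ∀ b ∈ E, IsLink G A B b (p b)
  disjoint : ∀ b ∈ E, ∀ c ∈ E, b ≠ c → ∀ x ∈ p b, x ∉ p c

variable {V : Type u} {G : SimpleGraph V} {A B B' E E' : Set V}

theorem IsLink.mem {b : V} {l : List V} (h : IsLink G A B b l) : b ∈ l := by
  obtain ⟨t, rfl, -⟩ := h.start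
  simp

theorem IsLink.eq_of_mem {b x : V} {l : List V} (h : IsLink G A B b l) (hx : x ∈ l)
    (hB : x ∈ B) : x = b := by
  obtain ⟨t, rfl, ht⟩ := h.start
  rcases List.mem_cons.1 hx with h | h
  · exact h
  · exact absurd hB (ht x h)

/-- Every walk from `B` to `A` contains a path which meets `B` only in its first vertex. -/
theorem exists_isLink_of_walk {b a : V} (w : G.Walk b a) (hb : b ∈ B) (ha : a ∈ A) :
    ∃ r ∈ B, ∃ l, IsLink G A B r l ∧ ∀ x ∈ l, x ∈ w.support := by
  classical
  obtain ⟨l₁, r, l₂, e, hr, h₂⟩ := exists_split_last B w.bypass.support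
    ⟨b, w.bypass.start_mem_support, hb⟩
  have hc := w.bypass.isChain_adj_support
  have hn := w.bypass_isPath.support_nodup
  have hl : w.bypass.support.getLast? = some a := by
    rw [List.getLast?_eq_some_getLast (by simp)]; simp
  rw [e] at hc hn hl
  refine ⟨r, hr, r :: l₂, ⟨hc.right_of_append, hn.of_append_right, ⟨l₂, rfl, h₂⟩, a, ha, ?_⟩, ?_⟩
  · simpa [List.getLast?_cons] using hl
  · intro x hx
    apply w.support_bypass_subset_support
    rw [e]
    exact List.mem_append_right _ hx

/-- `K` lists the vertices of a path which starts in `b` and whose other vertices avoid `B`. -/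
structure IsFront (G : SimpleGraph V) (B : Set V) (b : V) (K : List V) : Prop where
  chain : K.IsChain G.Adj
  nodup : K.Nodup
  start : ∃ t, K = b :: t ∧ ∀ x ∈ t, x ∉ B

theorem IsLink.isFront {b : V} {l : List V} (h : IsLink G A B b l) : IsFront G B b l :=
  ⟨h.chain, h.nodup, h.start⟩

theorem IsFront.mem {b : V} {l : List V} (h : IsFront G B b l) : b ∈ l := by
  obtain ⟨t, rfl, -⟩ := h.start
  simp

theorem IsFront.take {b y : V} {K₁ K₂ : List V} (h : IsFront G B b (K₁ ++ y :: K₂)) :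
    IsFront G B b (K₁ ++ [y]) := by
  obtain ⟨hc, hn, t, ht, ht'⟩ := h
  refine ⟨(List.isChain_split.1 hc).1, ?_, ?_⟩
  · rw [List.append_cons] at hn
    exact hn.of_append_left
  · rcases K₁ with _ | ⟨d, K₁⟩
    · simp only [List.nil_append, List.cons.injEq] at ht
      exact ⟨[], by simp [ht.1], by simp⟩
    · simp only [List.cons_append, List.cons.injEq] at ht
      obtain ⟨rfl, rfl⟩ := ht
      exact ⟨K₁ ++ [y], rfl, fun x hx => ht' x (by simp at hx ⊢; tauto)⟩

/-- Extending the paths of a linkage at their first vertices. -/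
theorem IsLinkage.glue {q : V → List V} (hq : IsLinkage G A B' E q) (hB : B ⊆ B')
    (hE : E' ⊆ B) (F : V → List V) (z : V → V) (hz : ∀ b ∈ E', z b ∈ E)
    (hF : ∀ b ∈ E', ∀ x ∈ F b, x ∈ B')
    (hf : ∀ b ∈ E', IsFront G B b (F b ++ [z b]))
    (hd : ∀ b ∈ E', ∀ c ∈ E', b ≠ c → ∀ x ∈ F b ++ [z b], x ∉ F c ++ [z c]) :
    IsLinkage G A B E' (fun b => F b ++ q (z b)) := by
  refine ⟨hE, ?_, ?_⟩
  · intro b hb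
    have hl := hq.link _ (hz b hb)
    obtain ⟨t, ht, ht'⟩ := hl.start
    obtain ⟨a, ha, hla⟩ := hl.finish
    have hch := hl.chain
    have hnd := hl.nodup
    obtain ⟨hc, hn, s, hs1, hs2⟩ := hf b hb
    rw [ht] at hch hnd hla
    have e : F b ++ q (z b) = b :: (s ++ t) := by
      rw [ht, ← List.cons_append, ← hs1]; simp
    refine ⟨?_, ?_, ⟨s ++ t, e, ?_⟩, a, ha, ?_⟩
    · simp only [ht]
      exact List.isChain_split.2 ⟨hc, hch⟩
    · simp only [ht]
      have h1 := hn
      have h3 := hF b hb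
      have h4 := hq.subset (hz b hb)
      rw [List.nodup_append] at h1 ⊢
      refine ⟨h1.1, hnd, ?_⟩
      intro x hx y hy
      rcases List.mem_cons.1 hy with rfl | hy
      · exact h1.2.2 x hx _ (by simp)
      · rintro rfl
        exact ht' _ hy (h3 _ hx)
    · intro x hx
      rcases List.mem_append.1 hx with hx | hx
      · exact hs2 x hx
      · exact fun h => ht' x hx (hB h)
    · simp only [ht, List.getLast?_append, hla]; simp
  · intro b hb c hc' hbc x hx hx'
    -- Inside `B'` the glued paths consist only of their new heads, outside it only of tails from
    -- `q`, so disjointness splits into these two cases.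
    have key : ∀ b ∈ E', x ∈ F b ++ q (z b) → x ∈ B' → x ∈ F b ++ [z b] := by
      intro b hb hx hxB
      obtain ⟨t, ht, ht'⟩ := (hq.link _ (hz b hb)).start
      rw [ht] at hx
      rcases List.mem_append.1 hx with h | h
      · exact List.mem_append_left _ h
      · rcases List.mem_cons.1 h with rfl | h
        · simp
        · exact absurd hxB (ht' x h)
    by_cases hxB : x ∈ B'
    · exact hd b hb c hc' hbc x (key b hb hx hxB) (key c hc' hx' hxB)
    · have h1 : x ∈ q (z b) := (List.mem_append.1 hx).resolve_left fun h => hxB (hF b hb x h)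
      have h2 : x ∈ q (z c) := (List.mem_append.1 hx').resolve_left fun h => hxB (hF c hc' x h)
      refine hq.disjoint _ (hz b hb) _ (hz c hc') ?_ x h1 h2
      intro e
      exact hd b hb c hc' hbc (z b) (by simp) (by simp [e])

open Classical in
/-- Extending two paths of a linkage at their first vertices `x` and `y`. -/
theorem IsLinkage.glue_two {q : V → List V} {x y f₁ f₂ : V} {K₁ K₂ : List V}
    (hq : IsLinkage G A B' (insert y (insert x E)) q) (hB : B ⊆ B') (hE : E ⊆ B)
    (hf₁ : f₁ ∈ B) (hf₂ : f₂ ∈ B) (h₁ : IsFront G B f₁ (K₁ ++ [x]))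
    (h₂ : IsFront G B f₂ (K₂ ++ [y])) (hK₁ : ∀ u ∈ K₁, u ∈ B') (hK₂ : ∀ u ∈ K₂, u ∈ B')
    (hd : ∀ u ∈ K₁ ++ [x], u ∉ K₂ ++ [y]) (hE₁ : ∀ c ∈ E, c ∉ K₁ ++ [x])
    (hE₂ : ∀ c ∈ E, c ∉ K₂ ++ [y]) :
    ∃ p, IsLinkage G A B (insert f₁ (insert f₂ E)) p := by
  have hne : f₂ ≠ f₁ := by
    rintro rfl
    exact hd _ h₁.mem h₂.mem
  have hE₁' : ∀ c ∈ E, c ≠ f₁ := by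
    rintro c hc rfl
    exact hE₁ _ hc h₁.mem
  have hE₂' : ∀ c ∈ E, c ≠ f₂ := by
    rintro c hc rfl
    exact hE₂ _ hc h₂.mem
  let F : V → List V := fun b => if b = f₁ then K₁ else if b = f₂ then K₂ else []
  let z : V → V := fun b => if b = f₁ then x else if b = f₂ then y else b
  have F₁ : F f₁ = K₁ := by simp [F]
  have F₂ : F f₂ = K₂ := by simp [F, hne]
  have F₃ : ∀ c ∈ E, F c = [] := fun c hc => by simp [F, hE₁' c hc, hE₂' c hc]
  have z₁ : z f₁ = x := by simp [z]
  have z₂ : z f₂ = y := by simp [z, hne]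
  have z₃ : ∀ c ∈ E, z c = c := fun c hc => by simp [z, hE₁' c hc, hE₂' c hc]
  refine ⟨_, hq.glue hB ?_ F z ?_ ?_ ?_ ?_⟩
  · rintro c (rfl | rfl | hc)
    exacts [hf₁, hf₂, hE hc]
  · rintro c (rfl | rfl | hc)
    · simp [z₁]
    · simp [z₂]
    · simp [z₃ c hc, hc]
  · rintro c (rfl | rfl | hc)
    · rwa [F₁]
    · rwa [F₂]
    · simp [F₃ c hc]
  · rintro c (rfl | rfl | hc)
    · rwa [F₁, z₁]
    · rwa [F₂, z₂]
    · rw [F₃ c hc, z₃ c hc]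
      exact ⟨by simp, by simp, [], by simp, by simp⟩
  · rintro c (rfl | rfl | hc) d (rfl | rfl | hd') hcd u hu
    · exact absurd rfl hcd
    · rw [F₁, z₁] at hu
      rw [F₂, z₂]
      exact hd u hu
    · rw [F₁, z₁] at hu
      rw [F₃ d hd', z₃ d hd']
      simp only [List.nil_append, List.mem_singleton]
      rintro rfl
      exact hE₁ _ hd' hu
    · rw [F₂, z₂] at hu
      rw [F₁, z₁]
      exact fun h => hd u h hu
    · exact absurd rfl hcd
    · rw [F₂, z₂] at hu
      rw [F₃ d hd', z₃ d hd']
      simp only [List.nil_append, List.mem_singleton]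
      rintro rfl
      exact hE₂ _ hd' hu
    · rw [F₃ c hc, z₃ c hc] at hu
      simp only [List.nil_append, List.mem_singleton] at hu
      subst hu
      rw [F₁, z₁]
      exact hE₁ _ hc
    · rw [F₃ c hc, z₃ c hc] at hu
      simp only [List.nil_append, List.mem_singleton] at hu
      subst hu
      rw [F₂, z₂]
      exact hE₂ _ hc
    · rw [F₃ c hc, z₃ c hc] at hu
      rw [F₃ d hd', z₃ d hd']
      simp only [List.nil_append, List.mem_singleton] at hu ⊢
      rintro rfl
      exact hcd hu.symm

end GraphEnd

namespace GraphEnd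

variable {V : Type u} {G : SimpleGraph V}

open Classical in
/-- Cutting one path of a linkage at a vertex `x` off `B`, where `B` is enlarged by the removed
segment and by a further set which avoids the linkage. -/
theorem IsLinkage.cut {A B : Set V} {E : Set V} {p : V → List V} (hp : IsLinkage G A B E p)
    {e x : V} {P₁ P₂ : List V} (he : e ∈ E) (hP : p e = P₁ ++ x :: P₂) (hxB : x ∉ B)
    {R : Set V} (hR : ∀ c ∈ E, ∀ y ∈ p c, y ∉ R) :
    IsLinkage G A (B ∪ {y | y ∈ P₁} ∪ {x} ∪ R) (insert x (E \ {e}))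
      (Function.update p x (x :: P₂)) := by
  have hle := hp.link e he
  have hxe : x ∈ p e := by simp [hP]
  have hne : ∀ c ∈ E \ {e}, c ≠ x := by
    rintro c hc rfl
    exact hxB (hp.subset hc.1)
  have hn := hle.nodup
  have hch := hle.chain
  rw [hP] at hn hch
  have hdis : ∀ c ∈ E \ {e}, ∀ y ∈ p e, y ∉ p c := fun c hc y hy =>
    hp.disjoint e he c hc.1 (fun h => hc.2 h.symm) y hy
  refine ⟨?_, ?_, ?_⟩
  · rintro c (rfl | hc)
    · simp
    · exact Or.inl (Or.inl (Or.inl (hp.subset hc.1)))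
  · rintro c (rfl | hc)
    · rw [Function.update_self]
      refine ⟨hch.right_of_append, hn.of_append_right, ⟨P₂, rfl, ?_⟩, ?_⟩
      · intro y hy hyB
        have hye : y ∈ p e := by simp [hP, hy]
        rw [List.nodup_append] at hn
        rcases hyB with ((hyB | hyB) | hyB) | hyB
        · obtain rfl := hle.eq_of_mem hye hyB
          obtain ⟨t, ht, ht'⟩ := hle.start
          rw [hP] at ht
          cases P₁ with
          | nil =>
            simp only [List.nil_append, List.cons.injEq] at ht
            exact hxB (ht.1 ▸ hyB)
          | cons d P₁ =>
            simp only [List.cons_append, List.cons.injEq] at ht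
            exact ht' y (by rw [← ht.2]; simp [hy]) hyB
        · exact hn.2.2 y hyB y (List.mem_cons_of_mem _ hy) rfl
        · rw [Set.mem_singleton_iff] at hyB
          subst hyB
          exact (List.nodup_cons.1 hn.2.1).1 hy
        · exact hR e he y hye hyB
      · obtain ⟨a, ha, hl⟩ := hle.finish
        refine ⟨a, ha, ?_⟩
        rw [hP] at hl
        simpa [List.getLast?_cons] using hl
    · rw [Function.update_of_ne (hne c hc)]
      have hl := hp.link c hc.1
      refine ⟨hl.chain, hl.nodup, ?_, hl.finish⟩
      obtain ⟨t, ht, ht'⟩ := hl.start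
      refine ⟨t, ht, ?_⟩
      intro y hy hyB
      have hyc : y ∈ p c := by simp [ht, hy]
      rcases hyB with ((hyB | hyB) | hyB) | hyB
      · exact ht' y hy hyB
      · exact hdis c hc y (by rw [hP]; exact List.mem_append_left _ hyB) hyc
      · rw [Set.mem_singleton_iff] at hyB
        exact hdis c hc y (hyB ▸ hxe) hyc
      · exact hR c hc.1 y hyc hyB
  · have hsub : ∀ y ∈ x :: P₂, y ∈ p e := by
      intro y hy
      rw [hP]
      exact List.mem_append_right _ hy
    rintro c (rfl | hc) d (rfl | hd) hcd y hy
    · exact absurd rfl hcd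
    · rw [Function.update_self] at hy
      rw [Function.update_of_ne (hne d hd)]
      exact hdis d hd y (hsub y hy)
    · rw [Function.update_of_ne (hne c hc)] at hy
      rw [Function.update_self]
      exact fun h => hdis c hc y (hsub y h) hy
    · rw [Function.update_of_ne (hne c hc)] at hy
      rw [Function.update_of_ne (hne d hd)]
      exact hp.disjoint c hc.1 d hd.1 hcd y hy

open Classical in
/-- The augmentation step in the proof of Menger's theorem: a linkage which is not separated by
as many vertices as it has paths extends by one path, keeping its end-vertices in `B`. -/
theorem IsLinkage.augment (A : Set V) (n : ℕ) : ∀ (B : Set V) (E : Finset V) (p : V → List V),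
    IsLinkage G A B E p → ∑ b ∈ E, (p b).length = n →
    (∀ X : Finset V, X.card ≤ E.card → ∃ b ∈ B, ∃ a ∈ A, ∃ w : G.Walk b a,
      ∀ x ∈ w.support, x ∉ X) →
    ∃ y ∈ B, y ∉ E ∧ ∃ p', IsLinkage G A B (insert y E : Finset V) p' := by
  induction n using Nat.strong_induction_on with
  | _ n ih =>
  intro B E p hp hn hX
  -- Taking `E` itself as the set to avoid gives a path that misses all present starting vertices.
  obtain ⟨b₀, hb₀, a₀, ha₀, w, hw⟩ := hX E le_rfl
  obtain ⟨r, hr, R, hR, hRw⟩ := exists_isLink_of_walk w hb₀ ha₀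
  have hRE : ∀ x ∈ R, x ∉ E := fun x hx => hw x (hRw x hx)
  have hrE : r ∉ E := hRE r hR.mem
  by_cases hmeet : ∃ x ∈ R, x ∈ {x | ∃ c ∈ E, x ∈ p c}
  swap
  · push Not at hmeet
    have hmeet' : ∀ x ∈ R, ∀ c ∈ E, x ∉ p c := fun x hx c hc h => hmeet x hx ⟨c, hc, h⟩
    have hne : ∀ c ∈ E, c ≠ r := by
      rintro c hc rfl
      exact hrE hc
    refine ⟨r, hr, hrE, Function.update p r R, ?_⟩
    rw [Finset.coe_insert]
    refine ⟨?_, ?_, ?_⟩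
    · rintro c (rfl | hc)
      exacts [hr, hp.subset hc]
    · rintro c (rfl | hc)
      · simpa using hR
      · rw [Function.update_of_ne (hne c hc)]
        exact hp.link c hc
    · rintro c (rfl | hc) d (rfl | hd) hcd x hx
      · exact absurd rfl hcd
      · rw [Function.update_self] at hx
        rw [Function.update_of_ne (hne d hd)]
        exact hmeet' x hx d hd
      · rw [Function.update_of_ne (hne c hc)] at hx
        rw [Function.update_self]
        exact fun h => hmeet' x h c hc hx
      · rw [Function.update_of_ne (hne c hc)] at hx
        rw [Function.update_of_ne (hne d hd)]
        exact hp.disjoint c hc d hd hcd x hx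
  -- The new path first hits the linkage in `x`, on the path from `e`. Cutting there and adding both
  -- initial segments to `B` gives a shorter linkage to which induction applies.
  obtain ⟨R₁, x, R₂, rfl, ⟨e, he, hxe⟩, hR₁⟩ := exists_split_first _ R hmeet
  obtain ⟨P₁, P₂, hP⟩ := List.append_of_mem hxe
  have hR₁' : ∀ c ∈ E, ∀ y ∈ p c, y ∉ {y | y ∈ R₁} := fun c hc y hy hy' => hR₁ y hy' ⟨c, hc, hy⟩
  have hle := hp.link e he
  have hxB : x ∉ B := by
    intro h
    obtain rfl := hle.eq_of_mem hxe h
    exact hRE x (by simp) he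
  have hcut := hp.cut he hP hxB hR₁'
  set B' := B ∪ {y | y ∈ P₁} ∪ {x} ∪ {y | y ∈ R₁}
  have hxE : x ∉ E := fun h => hxB (hp.subset h)
  have hE' : (insert x ((E : Set V) \ {e})) = ((insert x (E.erase e) : Finset V) : Set V) := by
    simp
  rw [hE'] at hcut
  have hcard : (insert x (E.erase e)).card = E.card := by
    rw [Finset.card_insert_of_notMem (by simp [hxE]), Finset.card_erase_add_one he]
  obtain ⟨y, hyB', hyE, q, hq⟩ := ih _ (by
      rw [Finset.sum_insert (by simp [hxE]), ← hn, ← Finset.add_sum_erase E _ he,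
        Function.update_self, Finset.sum_congr rfl (fun c hc => by
          rw [Function.update_of_ne (by rintro rfl; exact hxE (Finset.mem_of_mem_erase hc))]), hP]
      -- The total length really drops: `x` is not in `B`, so it is not the first vertex of its
      -- path.
      have : 0 < P₁.length := by
        rcases P₁ with _ | ⟨d, P₁⟩
        · obtain ⟨t, ht, -⟩ := hle.start
          rw [hP] at ht
          simp only [List.nil_append, List.cons.injEq] at ht
          exact absurd (hp.subset he) (ht.1 ▸ hxB)
        · simp
      simp
      omega) B' _ _ hcut rfl (by
      intro X hXc
      obtain ⟨b, hb, h⟩ := hX X (by omega)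
      exact ⟨b, Or.inl (Or.inl (Or.inl hb)), h⟩)
  have hBB' : B ⊆ B' := fun b hb => Or.inl (Or.inl (Or.inl hb))
  have hyx : y ≠ x := by rintro rfl; simp at hyE
  have hyc : ∀ c ∈ E, c ≠ e → y ≠ c := by
    rintro c hc hce rfl
    simp [hc, hce] at hyE
  have hPf : IsFront G B e (P₁ ++ [x]) := IsFront.take (hP ▸ hle.isFront)
  have hRf : IsFront G B r (R₁ ++ [x]) := hR.isFront.take
  have hPe : ∀ u ∈ P₁ ++ [x], u ∈ p e := by
    intro u hu
    rw [hP]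
    simp only [List.mem_append, List.mem_cons, List.not_mem_nil, or_false] at hu ⊢
    tauto
  have hPR : ∀ u ∈ P₁ ++ [x], u ∉ R₁ := fun u hu hu' => hR₁ u hu' ⟨e, he, hPe u hu⟩
  have hcP : ∀ c ∈ (E : Set V) \ {e}, c ∉ P₁ ++ [x] := fun c hc hc' =>
    hp.disjoint e he c hc.1 (fun h => hc.2 h.symm) c (hPe c hc') (hp.link c hc.1).mem
  have hcR : ∀ c ∈ (E : Set V) \ {e}, c ∉ R₁ := fun c hc hc' =>
    hR₁ c hc' ⟨c, hc.1, (hp.link c hc.1).mem⟩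
  have hEB : (E : Set V) \ {e} ⊆ B := fun c hc => hp.subset hc.1
  have hPB' : ∀ u ∈ P₁, u ∈ B' := fun u hu => Or.inl (Or.inl (Or.inr hu))
  have hRB' : ∀ u ∈ R₁, u ∈ B' := fun u hu => Or.inr hu
  have heB := hp.subset he
  have hxP : x ∉ P₁ := by
    have := hPf.nodup
    rw [List.nodup_append] at this
    exact fun h => this.2.2 x h x (by simp) rfl
  rw [Finset.coe_insert, ← hE'] at hq
  have hins : ∀ f, ((insert f E : Finset V) : Set V) = insert f (insert e ((E : Set V) \ {e})) := by
    intro f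
    rw [Finset.coe_insert, Set.insert_sdiff_singleton, Set.insert_eq_of_mem he]
  have hyE' : ∀ c ∈ (E : Set V) \ {e}, c ≠ y := fun c hc h => hyc c hc.1 hc.2 h.symm
  -- The new start `y` found by induction has to be led back to `B`. If it is on `P₁`, then `e` runs
  -- along `P₁` to `y` and `r` runs along `R₁` to `x`.
  by_cases hyP : y ∈ P₁
  · obtain ⟨Pa, Pb, hPa⟩ := List.append_of_mem hyP
    have hsub : ∀ u ∈ Pa ++ [y], u ∈ P₁ := by
      intro u hu
      rw [hPa]
      simp only [List.mem_append, List.mem_cons, List.not_mem_nil, or_false] at hu ⊢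
      tauto
    refine ⟨r, hr, hrE, ?_⟩
    rw [hins]
    refine hq.glue_two (K₁ := R₁) (K₂ := Pa) hBB' hEB hr heB hRf ?_ hRB' ?_ ?_ ?_ ?_
    · rw [hPa, List.append_assoc, List.cons_append] at hPf
      exact hPf.take
    · exact fun u hu => hPB' u (hsub u (List.mem_append_left _ hu))
    · intro u hu hu'
      rcases List.mem_append.1 hu with hu | hu
      · exact hPR u (List.mem_append_left _ (hsub u hu')) hu
      · rw [List.mem_singleton] at hu
        exact hxP (hu ▸ hsub u hu')
    · intro c hc hc'
      rcases List.mem_append.1 hc' with h | h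
      · exact hcR c hc h
      · exact hcP c hc (List.mem_append_right _ h)
    · exact fun c hc hc' => hcP c hc (List.mem_append_left _ (hsub c hc'))
  -- Here the roles are exchanged: `e` runs along `P₁` to `x`, and `r` along `R₁` to `y`. Otherwise
  -- `y` is in `B` already and is the new start itself.
  by_cases hyR : y ∈ R₁
  · obtain ⟨Ra, Rb, hRa⟩ := List.append_of_mem hyR
    have hsub : ∀ u ∈ Ra ++ [y], u ∈ R₁ := by
      intro u hu
      rw [hRa]
      simp only [List.mem_append, List.mem_cons, List.not_mem_nil, or_false] at hu ⊢
      tauto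
    refine ⟨r, hr, hrE, ?_⟩
    rw [hins, Set.insert_comm]
    refine hq.glue_two (K₁ := P₁) (K₂ := Ra) hBB' hEB heB hr hPf ?_ hPB' ?_ ?_ hcP ?_
    · rw [hRa, List.append_assoc, List.cons_append] at hRf
      exact hRf.take
    · exact fun u hu => hRB' u (hsub u (List.mem_append_left _ hu))
    · exact fun u hu hu' => hPR u hu (hsub u hu')
    · exact fun c hc hc' => hcR c hc (hsub c hc')
  · have hyB : y ∈ B := by
      rcases hyB' with ((h | h) | h) | h
      exacts [h, absurd h hyP, absurd h hyx, absurd h hyR]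
    have hye : y ≠ e := by
      rintro rfl
      have := hPf.mem
      simp only [List.mem_append, List.mem_singleton] at this
      tauto
    refine ⟨y, hyB, fun h => hyc y h hye rfl, ?_⟩
    rw [hins, Set.insert_comm]
    refine hq.glue_two (K₁ := P₁) (K₂ := []) hBB' hEB heB hyB hPf
      ⟨by simp, by simp, [], by simp, by simp⟩ hPB' (by simp) ?_ hcP ?_
    · intro u hu hu'
      simp only [List.nil_append, List.mem_singleton] at hu'
      subst hu'
      simp only [List.mem_append, List.mem_singleton] at hu
      tauto
    · intro c hc
      simpa using hyE' c hc

/-- Menger's theorem: if `B` is finite and no set of fewer than `|B|` vertices separates `B` from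
`A`, then there are pairwise disjoint paths from all the vertices of `B` to `A`. -/
theorem exists_isLinkage (A : Set V) (B : Finset V)
    (h : ∀ X : Finset V, X.card < B.card → ∃ b ∈ B, ∃ a ∈ A, ∃ w : G.Walk b a,
      ∀ x ∈ w.support, x ∉ X) :
    ∃ p, IsLinkage G A B B p := by
  classical
  have key : ∀ k ≤ B.card, ∃ E : Finset V, E.card = k ∧ ∃ p, IsLinkage G A B E p := by
    intro k
    induction k with
    | zero => exact fun _ => ⟨∅, rfl, fun _ => [], by simp, by simp, by simp⟩
    | succ k ih =>
      intro hk
      obtain ⟨E, hE, p, hp⟩ := ih (by omega)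
      obtain ⟨y, -, hyE, p', hp'⟩ := IsLinkage.augment A _ _ E p hp rfl
        (fun X hX => h X (by omega))
      exact ⟨insert y E, by rw [Finset.card_insert_of_notMem hyE, hE], p', hp'⟩
  obtain ⟨E, hE, p, hp⟩ := key _ le_rfl
  obtain rfl : E = B := Finset.eq_of_subset_of_card_le (by exact_mod_cast hp.subset) hE.ge
  exact ⟨p, hp⟩

end GraphEnd

/-! ### Components containing a tail of a ray, and separating finite sets from an end. -/

namespace GraphEnd

variable {V : Type u} {G : SimpleGraph V}

/-- The vertex set of the component of `G - T` in which `R` has a tail: the vertices joined to all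
late vertices of `R` by walks which avoid `T`. -/
def Ray.component (R : Ray G) (T : Set V) : Set V :=
  {v | ∃ N, ∀ n, N ≤ n → ∃ p : G.Walk v (R.vert n), ∀ x ∈ p.support, x ∉ T}

namespace Ray

variable {R : Ray G} {S T : Set V} {u v : V}

theorem notMem_of_mem_component (h : v ∈ R.component T) : v ∉ T := by
  obtain ⟨N, hN⟩ := h
  obtain ⟨p, hp⟩ := hN N le_rfl
  exact hp v p.start_mem_support

theorem mem_component_of_walk (h : v ∈ R.component T) (p : G.Walk u v)
    (hp : ∀ x ∈ p.support, x ∉ T) : u ∈ R.component T := by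
  obtain ⟨N, hN⟩ := h
  refine ⟨N, fun n hn => ?_⟩
  obtain ⟨q, hq⟩ := hN n hn
  refine ⟨p.append q, fun x hx => ?_⟩
  rcases (SimpleGraph.Walk.mem_support_append_iff _ _).1 hx with hx | hx
  exacts [hp x hx, hq x hx]

theorem mem_component_of_adj (h : v ∈ R.component T) (hu : u ∉ T) (ha : G.Adj v u) :
    u ∈ R.component T := by
  refine mem_component_of_walk h (SimpleGraph.Walk.cons ha.symm .nil) ?_
  intro x hx
  simp only [SimpleGraph.Walk.support_cons, SimpleGraph.Walk.support_nil, List.mem_cons,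
    List.not_mem_nil, or_false] at hx
  rcases hx with rfl | rfl
  exacts [hu, notMem_of_mem_component h]

/-- All vertices on a walk witnessing membership in `R.component S` are in that component
themselves, so the walk avoids `T`. -/
theorem component_subset (h : ∀ x ∈ T, x ∉ R.component S) : R.component S ⊆ R.component T := by
  classical
  rintro v hv
  obtain ⟨N, hN⟩ := hv
  refine ⟨N, fun n hn => ?_⟩
  obtain ⟨p, hp⟩ := hN n hn
  refine ⟨p, fun x hx hxT => h x hxT ?_⟩
  refine mem_component_of_walk ⟨N, hN⟩ (p.takeUntil x hx).reverse fun y hy => hp y ?_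
  rw [SimpleGraph.Walk.support_reverse, List.mem_reverse] at hy
  exact p.support_takeUntil_subset_support hx hy

theorem eventually_notMem (R : Ray G) (hT : T.Finite) : ∃ N, ∀ n, N ≤ n → R.vert n ∉ T := by
  obtain ⟨M, hM⟩ := (hT.preimage R.injective.injOn).bddAbove
  exact ⟨M + 1, fun n hn h => absurd (hM h) (by omega)⟩

theorem exists_walk (R : Ray G) {m n : ℕ} (hmn : m ≤ n) :
    ∃ p : G.Walk (R.vert m) (R.vert n), ∀ x ∈ p.support, ∃ i, m ≤ i ∧ x = R.vert i := by
  induction n, hmn using Nat.le_induction with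
  | base => exact ⟨.nil, fun x hx => ⟨m, le_rfl, by simpa using hx⟩⟩
  | succ n hn ih =>
    obtain ⟨p, hp⟩ := ih
    refine ⟨p.concat (R.adj n), fun x hx => ?_⟩
    rw [SimpleGraph.Walk.support_concat, List.mem_append, List.mem_singleton] at hx
    rcases hx with hx | rfl
    exacts [hp x hx, ⟨n + 1, by omega, rfl⟩]

theorem hasTailIn_component (R : Ray G) (hT : T.Finite) : R.HasTailIn (R.component T) := by
  obtain ⟨N, hN⟩ := R.eventually_notMem hT
  refine ⟨N, fun n hn => ⟨n, fun m hm => ?_⟩⟩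
  obtain ⟨p, hp⟩ := R.exists_walk hm
  refine ⟨p, fun x hx => ?_⟩
  obtain ⟨i, hi, rfl⟩ := hp x hx
  exact hN i (by omega)

theorem hasTailIn_mono {A B : Set V} (h : A ⊆ B) (hR : R.HasTailIn A) : R.HasTailIn B :=
  let ⟨N, hN⟩ := hR
  ⟨N, fun n hn => h (hN n hn)⟩

theorem mem_componentCompl_of_walk {C : G.ComponentCompl T} (p : G.Walk u v) (hv : v ∈ C)
    (hp : ∀ x ∈ p.support, x ∉ T) : u ∈ C := by
  induction p with
  | nil => exact hv
  | cons h p ih =>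
    refine SimpleGraph.ComponentCompl.mem_of_adj _ _ (ih hv fun x hx => hp x (by simp [hx]))
      (hp _ (by simp)) h.symm

theorem exists_walk_of_mem_componentCompl {C : G.ComponentCompl T} (hu : u ∈ C) (hv : v ∈ C) :
    ∃ p : G.Walk u v, ∀ x ∈ p.support, x ∉ T := by
  obtain ⟨hu', rfl⟩ := hu
  obtain ⟨hv', e⟩ := hv
  obtain ⟨p⟩ := SimpleGraph.ConnectedComponent.eq.1 e.symm
  refine ⟨p.map (SimpleGraph.Embedding.induce (G := G) Tᶜ).toHom, fun x hx => ?_⟩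
  replace hx := (SimpleGraph.Walk.support_map _ p) ▸ hx
  rw [List.mem_map] at hx
  obtain ⟨y, -, rfl⟩ := hx
  exact y.2

/-- Replaces `ComponentCompl` by walks towards one fixed ray, the form in which equivalence is
checked from here on. -/
theorem equivalent_iff {R' : Ray G} :
    R.Equivalent R' ↔ ∀ T : Set V, T.Finite → R'.HasTailIn (R.component T) := by
  constructor
  · intro h T hT
    obtain ⟨C, ⟨N, hN⟩, ⟨N', hN'⟩⟩ := h T hT
    exact ⟨N', fun n hn => ⟨N, fun m hm =>
      exists_walk_of_mem_componentCompl (hN' n hn) (hN m hm)⟩⟩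
  · intro h T hT
    obtain ⟨C, ⟨N, hN⟩, -⟩ := Equivalent.refl R T hT
    refine ⟨C, ⟨N, hN⟩, ?_⟩
    obtain ⟨M, hM⟩ := h T hT
    refine ⟨M, fun n hn => ?_⟩
    obtain ⟨K, hK⟩ := hM n hn
    obtain ⟨p, hp⟩ := hK (max K N) (le_max_left _ _)
    exact mem_componentCompl_of_walk p (hN _ (le_max_right _ _)) hp

theorem belongsTo_mk_iff {R' : Ray G} :
    R'.BelongsTo (Quotient.mk (raySetoid G) R : Ends G) ↔ R.Equivalent R' :=
  ⟨fun h => (raySetoid G).symm (Quotient.exact h), fun h => Quotient.sound ((raySetoid G).symm h)⟩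

end Ray

/-- Every walk with a vertex in `B` contains a path from `B` to the end of the walk which meets `B`
only in its first vertex. -/
theorem exists_isPath_from_last {u v : V} (B : Set V) (p : G.Walk u v)
    (h : ∃ x ∈ p.support, x ∈ B) :
    ∃ r ∈ B, ∃ q : G.Walk r v, q.IsPath ∧ (∀ x ∈ q.support, x ∈ p.support) ∧
      ∀ x ∈ q.support, x = r ∨ x ∉ B := by
  classical
  suffices hs : ∃ r ∈ B, ∃ q : G.Walk r v, (∀ x ∈ q.support, x ∈ p.support) ∧
      ∀ x ∈ q.support, x = r ∨ x ∉ B by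
    obtain ⟨r, hr, q, hq, hq'⟩ := hs
    exact ⟨r, hr, q.bypass, q.bypass_isPath,
      fun x hx => hq x (q.support_bypass_subset_support hx),
      fun x hx => hq' x (q.support_bypass_subset_support hx)⟩
  induction p with
  | @nil u =>
    obtain ⟨x, hx, hB⟩ := h
    obtain rfl : x = u := by simpa using hx
    exact ⟨x, hB, .nil, by simp, by simp⟩
  | @cons u w v h' p ih =>
    by_cases hp : ∃ x ∈ p.support, x ∈ B
    · obtain ⟨r, hr, q, hq, hq'⟩ := ih hp
      exact ⟨r, hr, q, fun x hx => by simp [hq x hx], hq'⟩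
    · push Not at hp
      obtain ⟨x, hx, hB⟩ := h
      rw [SimpleGraph.Walk.support_cons, List.mem_cons] at hx
      rcases hx with rfl | hx
      · refine ⟨x, hB, SimpleGraph.Walk.cons h' p, fun x hx => hx, fun y hy => ?_⟩
        rw [SimpleGraph.Walk.support_cons, List.mem_cons] at hy
        exact hy.imp_right (hp y)
      · exact absurd hB (hp x hx)

/-- A walk which ends in the component but starts outside of it contains a walk from the
separator which is inside the component except at its first vertex. -/
theorem Ray.exists_walk_from_separator {R : Ray G} {T : Set V} {u v : V} (p : G.Walk u v)
    (hu : u ∉ R.component T) (hv : v ∈ R.component T) :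
    ∃ s ∈ T, ∃ q : G.Walk s v, (∀ x ∈ q.support, x ∈ p.support) ∧
      ∀ x ∈ q.support, x = s ∨ x ∈ R.component T := by
  obtain ⟨s, hs, q, -, hq, hq'⟩ := exists_isPath_from_last (R.component T)ᶜ p
    ⟨u, p.start_mem_support, hu⟩
  simp only [Set.mem_compl_iff, not_not] at hs hq'
  refine ⟨s, ?_, q, hq, hq'⟩
  cases q with
  | nil => exact absurd hv hs
  | @cons _ w _ h q =>
    have hw : w ∈ R.component T :=
      (hq' w (by simp)).resolve_left h.ne.symm
    by_contra hT
    exact hs (mem_component_of_adj hw hT h.symm)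

/-- Finite sets `T` disjoint from `Y` which separate `Y` from the end of `R`. -/
structure Ray.Separates (R : Ray G) (Y T : Set V) : Prop where
  finite : T.Finite
  disjoint : Disjoint Y T
  disjoint_component : Disjoint Y (R.component T)

/-- If the end of `R` is dominated by no vertex of the finite set `Y`, then `Y` is separated from
it by a finite set disjoint from `Y`. -/
theorem Ray.exists_separates (R : Ray G) {Y : Set V} (hY : Y.Finite)
    (hdom : ∀ y ∈ Y, ¬ Dominates y (Quotient.mk (raySetoid G) R : Ends G)) :
    ∃ T, R.Separates Y T := by
  classical
  by_contra hno
  push Not at hno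
  have hno' : ∀ T : Set V, T.Finite → Disjoint Y T → ∃ y ∈ Y, y ∈ R.component T := by
    intro T hT hd
    by_contra hc
    push Not at hc
    exact hno T ⟨hT, hd, Set.disjoint_left.2 hc⟩
  have hsymm : Std.Symm (fun q q' : (Σ y : V, Σ w : V, G.Path y w) =>
      ∀ x ∈ q.2.2.1.support, x ∈ q'.2.2.1.support → x ∈ Y) :=
    ⟨fun q q' h x hx hx' => h x hx' hx⟩
  let good : (Σ y : V, Σ w : V, G.Path y w) → Prop := fun q =>
    q.1 ∈ Y ∧ q.2.1 ∈ R.verts \ Y ∧ ∀ x ∈ q.2.2.1.support, x = q.1 ∨ x ∉ Y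
  -- Greedy choice: the vertices outside `Y` on the paths found so far form a finite set that does
  -- not separate `Y`, so another path to `R` avoids them.
  have hstep : ∀ s : Finset (Σ y : V, Σ w : V, G.Path y w), (∀ q ∈ s, good q) →
      ∃ q', good q' ∧ ∀ q ∈ s, ∀ x ∈ q.2.2.1.support, x ∈ q'.2.2.1.support → x ∈ Y := by
    intro s hs
    let T : Set V := (⋃ q ∈ s, {x | x ∈ q.2.2.1.support}) \ Y
    have hT : T.Finite :=
      (Set.Finite.biUnion s.finite_toSet fun q _ => q.2.2.1.support.finite_toSet).sdiff
    obtain ⟨y, hy, N, hN⟩ := hno' T hT Set.disjoint_sdiff_right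
    obtain ⟨M, hM⟩ := R.eventually_notMem hY
    obtain ⟨p, hp⟩ := hN (max N M) (le_max_left _ _)
    obtain ⟨r, hr, q, hq, hqp, hqY⟩ := exists_isPath_from_last Y p ⟨y, p.start_mem_support, hy⟩
    refine ⟨⟨r, _, ⟨q, hq⟩⟩, ⟨hr, ⟨⟨_, rfl⟩, hM _ (le_max_right _ _)⟩, hqY⟩, ?_⟩
    intro q' hq' x hx hx'
    by_contra hxY
    refine hp x (hqp x hx') ⟨?_, hxY⟩
    simp only [Set.mem_iUnion]
    exact ⟨q', hq', hx⟩
  obtain ⟨f, hf, hf'⟩ := exists_seq_of_forall_finset_exists' good _ hstep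
  -- By pigeonhole infinitely many of the paths start in the same `y`; as they meet `Y` only there,
  -- they form a fan showing that `y` dominates.
  obtain ⟨y, hy, hinf⟩ : ∃ y ∈ Y, {n | (f n).1 = y}.Infinite := by
    by_contra hc
    push Not at hc
    have hu : (⋃ y ∈ Y, {n | (f n).1 = y}).Finite := hY.biUnion fun y hy => by
      simpa [Set.not_infinite] using hc y hy
    refine Set.infinite_univ (hu.subset fun n _ => ?_)
    simp only [Set.mem_iUnion, Set.mem_ofPred_eq, exists_prop]
    exact ⟨_, (hf n).1, rfl⟩
  have hch : ∀ n : {n | (f n).1 = y}, ∃ w, ∃ P : G.Path y w, w ∈ R.verts \ {y} ∧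
      (∀ x ∈ P.1.support, x = y ∨ x ∉ Y) ∧ ∀ x ∈ P.1.support, x ∈ (f n).2.2.1.support := by
    rintro ⟨n, hn⟩
    change (f n).1 = y at hn
    dsimp only
    obtain ⟨h1, h2, h3⟩ := hf n
    generalize f n = q at *
    obtain ⟨y', w, P⟩ := q
    obtain rfl : y' = y := hn
    exact ⟨w, P, ⟨h2.1, by rintro rfl; exact h2.2 hy⟩, h3, fun x hx => hx⟩
  choose w P hw hPY hPf using hch
  have em := hinf.natEmbedding
  refine hdom y hy ⟨R, rfl, fun i => w (em i), fun i => P (em i), fun i => hw _, ?_⟩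
  intro i j hij x hx hx'
  have hne : (em i : ℕ) ≠ em j := fun h => hij (em.injective (Subtype.ext h))
  exact (hPY _ x hx).resolve_right (not_not.2 (hf' hne x (hPf _ x hx) (hPf _ x hx')))

end GraphEnd

/-! ### Minimum separators and the linkings between them. -/

namespace GraphEnd

variable {V : Type u} {G : SimpleGraph V}

/-- From its last vertex outside `R.component Y`, which lies in `Y`, a walk from `Y` to a late
vertex of `R` stays in that component. There it can meet `T` only in `T ∩ R.component Y`. -/
theorem Ray.Separates.inter {R : Ray G} {Y T : Set V} (h : R.Separates Y T) (hY : Y.Finite) :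
    R.Separates Y (T ∩ R.component Y) := by
  refine ⟨h.finite.inter_of_left _, h.disjoint.mono_right Set.inter_subset_left, ?_⟩
  rw [Set.disjoint_left]
  rintro y hy ⟨N, hN⟩
  obtain ⟨M, hM⟩ := R.hasTailIn_component hY
  obtain ⟨M', hM'⟩ := R.hasTailIn_component h.finite
  obtain ⟨p, hp⟩ := hN (max N (max M M')) (by omega)
  obtain ⟨s, hs, q, hqp, hq⟩ := exists_walk_from_separator p
    (fun hc => notMem_of_mem_component hc hy) (hM (max N (max M M')) (by omega))
  refine Set.disjoint_left.1 h.disjoint_component hs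
    (mem_component_of_walk (hM' (max N (max M M')) (by omega)) q fun x hx hxT => ?_)
  rcases hq x hx with rfl | hxY
  · exact Set.disjoint_left.1 h.disjoint hs hxT
  · exact hp x (hqp x hx) ⟨hxT, hxY⟩

/-- `S` has minimum size among the sets which separate `Y` from the end of `R`, and it lies in the
component of `G - Y` in which `R` has a tail. -/
structure Ray.IsMinSeparator (R : Ray G) (Y S : Finset V) : Prop where
  separates : R.Separates Y S
  subset : (S : Set V) ⊆ R.component Y
  card_le : ∀ T : Finset V, R.Separates Y T → S.card ≤ T.card

theorem Ray.exists_isMinSeparator (R : Ray G) (Y : Finset V)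
    (hdom : ∀ y ∈ Y, ¬ Dominates y (Quotient.mk (raySetoid G) R : Ends G)) :
    ∃ S, R.IsMinSeparator Y S := by
  classical
  have hex : ∃ n, ∃ T : Finset V, R.Separates Y T ∧ T.card = n := by
    obtain ⟨T, hT⟩ := R.exists_separates Y.finite_toSet (by exact_mod_cast hdom)
    exact ⟨_, hT.finite.toFinset, by simpa using hT, rfl⟩
  obtain ⟨T, hT, hcard⟩ := Nat.find_spec hex
  have hT' := hT.inter Y.finite_toSet
  have e : ((hT'.finite.toFinset : Finset V) : Set V) = (T : Set V) ∩ R.component Y := by simp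
  refine ⟨hT'.finite.toFinset, by rwa [e], by rw [e]; exact Set.inter_subset_right, ?_⟩
  intro T₂ hT₂
  calc _ ≤ T.card := Finset.card_le_card (by
        rw [← Finset.coe_subset, e]; exact Set.inter_subset_left)
    _ = Nat.find hex := hcard
    _ ≤ T₂.card := Nat.find_min' hex ⟨T₂, hT₂, rfl⟩

theorem Ray.Separates.subset_component {R : Ray G} {Y S : Set V} (h : R.Separates Y S)
    (hS : S ⊆ R.component Y) : S ∪ R.component S ⊆ R.component Y := by
  refine Set.union_subset hS (component_subset fun x hx => ?_)
  exact Set.disjoint_left.1 h.disjoint_component hx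

/-- The spanning subgraph of `G` formed by the edges inside `K`. -/
def edgesInside (G : SimpleGraph V) (K : Set V) : SimpleGraph V where
  Adj u v := G.Adj u v ∧ u ∈ K ∧ v ∈ K
  symm := ⟨fun _ _ h => ⟨h.1.symm, h.2.2, h.2.1⟩⟩
  loopless := ⟨fun _ h => h.1.ne rfl⟩

theorem mem_of_isChain_edgesInside {K : Set V} {s : V} {t : List V}
    (h : (s :: t).IsChain (edgesInside G K).Adj) : ∀ x ∈ t, x ∈ K := by
  induction t generalizing s with
  | nil => simp
  | cons a t ih =>
    rw [List.isChain_cons_cons] at h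
    intro x hx
    rcases List.mem_cons.1 hx with rfl | hx
    exacts [h.1.2.2, ih h.2 x hx]

theorem exists_walk_edgesInside {K : Set V} {u v : V} (p : G.Walk u v)
    (h : ∀ x ∈ p.support, x ∈ K) :
    ∃ q : (edgesInside G K).Walk u v, ∀ x ∈ q.support, x ∈ p.support := by
  refine ⟨p.transfer _ fun e he => ?_, by simp⟩
  induction e with
  | _ a b =>
    exact ⟨p.adj_of_mem_edges he, h _ (p.fst_mem_support_of_mem_edges he),
      h _ (p.snd_mem_support_of_mem_edges he)⟩

/-- Pairwise disjoint paths from each of the vertices of `S` to `S'`, which are inside the component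
at `S` after their first vertex, and outside the component at `S'`. -/
structure Ray.IsLinking (R : Ray G) (S S' : Set V) (p : V → List V) : Prop where
  chain : ∀ s ∈ S, (p s).IsChain G.Adj
  nodup : ∀ s ∈ S, (p s).Nodup
  start : ∀ s ∈ S, ∃ t, p s = s :: t ∧ ∀ x ∈ t, x ∈ R.component S
  finish : ∀ s ∈ S, ∃ l, ∃ s' ∈ S', p s = l ++ [s'] ∧ ∀ x ∈ l, x ∉ S' ∪ R.component S'
  disjoint : ∀ s ∈ S, ∀ s' ∈ S, s ≠ s' → ∀ x ∈ p s, x ∉ p s'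

/-- Fewer than `S.card` vertices cannot separate `Y` from the end, so they cannot block all paths
from `S` to the far side of `S'`; Menger then links all of `S`. Using only edges inside `K` keeps
the paths in the component at `S`. -/
theorem Ray.IsMinSeparator.exists_isLinking {R : Ray G} {Y S S' : Finset V}
    (h : R.IsMinSeparator Y S) (h' : R.IsMinSeparator S S') : ∃ p, R.IsLinking S S' p := by
  classical
  set K : Set V := S ∪ R.component S
  set A : Set V := S' ∪ R.component S'
  obtain ⟨p, hp⟩ := exists_isLinkage (G := edgesInside G K) A S (by
    intro X hX
    -- Only vertices of `X` in `K` can block paths there, and `K` misses `Y`, so `X'` is disjoint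
    -- from `Y` as a separator has to be.
    set X' := X.filter (· ∈ K)
    have hYX : Disjoint (Y : Set V) X' := by
      rw [Set.disjoint_left]
      intro y hy hyX
      have : y ∈ K := (Finset.mem_filter.1 (Finset.mem_coe.1 hyX)).2
      exact notMem_of_mem_component (h.separates.subset_component h.subset this) hy
    have hns : ¬ R.Separates Y X' := fun hs =>
      absurd ((h.card_le _ hs).trans (Finset.card_filter_le _ _)) (by omega)
    obtain ⟨y, hy, N, hN⟩ : ∃ y ∈ Y, y ∈ R.component X' := by
      by_contra hc
      push Not at hc
      exact hns ⟨X'.finite_toSet, hYX, Set.disjoint_left.2 (by exact_mod_cast hc)⟩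
    obtain ⟨M, hM⟩ := R.hasTailIn_component S.finite_toSet
    obtain ⟨M', hM'⟩ := R.hasTailIn_component S'.finite_toSet
    obtain ⟨w, hw⟩ := hN (max N (max M M')) (by omega)
    obtain ⟨s, hs, q, hqw, hq⟩ := exists_walk_from_separator w
      (Set.disjoint_left.1 h.separates.disjoint_component hy) (hM (max N (max M M')) (by omega))
    have hqK : ∀ x ∈ q.support, x ∈ K := by
      intro x hx
      rcases hq x hx with rfl | hx
      exacts [Or.inl hs, Or.inr hx]
    obtain ⟨q', hq'⟩ := exists_walk_edgesInside q hqK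
    refine ⟨s, hs, _, Or.inr (hM' (max N (max M M')) (by omega)), q', fun x hx hxX => ?_⟩
    exact hw x (hqw x (hq' x hx))
      (Finset.mem_coe.2 (Finset.mem_filter.2 ⟨hxX, hqK x (hq' x hx)⟩)))
  have hSA : ∀ s ∈ S, s ∉ A := by
    rintro s hs (hs' | hs')
    · exact Set.disjoint_left.1 h'.separates.disjoint hs hs'
    · exact Set.disjoint_left.1 h'.separates.disjoint_component hs hs'
  have hsplit : ∀ s : V, ∃ l r, s ∈ S → r ∈ A ∧ (∀ x ∈ l, x ∉ A) ∧
      ∃ l₂, p s = l ++ r :: l₂ := by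
    intro s
    by_cases hs : s ∈ S
    · obtain ⟨a, ha, hla⟩ := (hp.link s hs).finish
      obtain ⟨l, r, l₂, e, hr, hl⟩ := exists_split_first A (p s) ⟨a, List.mem_of_getLast? hla, ha⟩
      exact ⟨l, r, fun _ => ⟨hr, hl, l₂, e⟩⟩
    · exact ⟨[], s, fun h => absurd h hs⟩
  choose l r hlr using hsplit
  have hfront : ∀ s ∈ S, IsFront (edgesInside G K) S s (l s ++ [r s]) := by
    intro s hs
    obtain ⟨-, -, l₂, e⟩ := hlr s hs
    exact IsFront.take (e ▸ (hp.link s hs).isFront)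
  refine ⟨fun s => l s ++ [r s], ?_, ?_, ?_, ?_, ?_⟩
  · exact fun s hs => (hfront s hs).chain.imp fun _ _ h => h.1
  · exact fun s hs => (hfront s hs).nodup
  · intro s hs
    obtain ⟨t, ht, ht'⟩ := (hfront s hs).start
    refine ⟨t, ht, fun x hx => ?_⟩
    have hc := (hfront s hs).chain
    rw [ht] at hc
    exact (mem_of_isChain_edgesInside hc x hx).resolve_left (ht' x hx)
  · intro s hs
    obtain ⟨hr, hl, -⟩ := hlr s hs
    -- If the first vertex in `A` were in the component at `S'`, its predecessor would be in `A`
    -- too; a predecessor exists because `S` misses `A`.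
    refine ⟨l s, r s, hr.resolve_right fun hr' => ?_, rfl, hl⟩
    have hc := (hfront s hs).chain
    rcases List.eq_nil_or_concat (l s) with e | ⟨l₀, u, e⟩
    · obtain ⟨t, ht, -⟩ := (hfront s hs).start
      rw [e, List.nil_append, List.cons.injEq] at ht
      exact hSA s hs (ht.1 ▸ hr)
    · rw [e, List.concat_eq_append, List.append_assoc, List.singleton_append, List.isChain_append_cons_cons] at hc
      have hu : u ∉ A := hl u (by simp [e])
      exact hu (Or.inr (mem_component_of_adj hr' (fun h => hu (Or.inl h)) hc.2.1.1.symm))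
  · intro s hs s' hs' hne x hx hxs
    have hsub : ∀ s ∈ S, x ∈ l s ++ [r s] → x ∈ p s := by
      intro s hs hx
      obtain ⟨-, -, l₂, e⟩ := hlr s hs
      rw [e, List.append_cons]
      exact List.mem_append_left _ hx
    exact hp.disjoint s hs s' hs' hne x (hsub s hs hx) (hsub s' hs' hxs)

/-- An increasing sequence of finite paths defines a ray. -/
theorem exists_ray_of_lists (L : ℕ → List V) (C : ℕ → Set V) (hC : Antitone C)
    (hL : ∀ i, ∃ t, L (i + 1) = L i ++ t ∧ ∀ x ∈ t, x ∈ C i) (hlen : ∀ i, i < (L i).length)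
    (hchain : ∀ i, (L i).IsChain G.Adj) (hnodup : ∀ i, (L i).Nodup) :
    ∃ R : Ray G, (∀ n i, n ≤ i → R.vert n ∈ L i) ∧ ∀ i, R.HasTailIn (C i) := by
  have hL' : ∀ i j, i ≤ j → ∃ t, L j = L i ++ t ∧ ∀ x ∈ t, x ∈ C i := by
    intro i j hij
    induction j, hij using Nat.le_induction with
    | base => exact ⟨[], by simp⟩
    | succ j hj ih =>
      obtain ⟨t, ht, ht'⟩ := ih
      obtain ⟨t₂, ht₂, ht₂'⟩ := hL j
      refine ⟨t ++ t₂, by rw [ht₂, ht, List.append_assoc], fun x hx => ?_⟩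
      rcases List.mem_append.1 hx with hx | hx
      exacts [ht' x hx, hC hj (ht₂' x hx)]
  have hget : ∀ n i (h : n ≤ i), (L n)[n]'(hlen n) = (L i)[n]'(h.trans_lt (hlen i)) := by
    intro n i h
    obtain ⟨t, ht, -⟩ := hL' n i h
    simp only [ht]
    rw [List.getElem_append_left (hlen n)]
  -- Entry `n` exists in `L n` and never changes in later lists.
  refine ⟨⟨fun n => (L n)[n]'(hlen n), ?_, ?_⟩, ?_, ?_⟩
  · intro m n hmn
    dsimp only at hmn
    rw [hget m (max m n) (le_max_left _ _), hget n (max m n) (le_max_right _ _)] at hmn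
    exact (hnodup _).getElem_inj_iff.1 hmn
  · intro n
    rw [hget n (n + 1) (by omega)]
    exact (hchain (n + 1)).getElem _ _
  · intro n i h
    dsimp only
    rw [hget n i h]
    exact List.getElem_mem _
  · intro i
    refine ⟨(L i).length, fun n hn => ?_⟩
    have hin : i ≤ n := (hlen i).le.trans hn
    obtain ⟨t, ht, ht'⟩ := hL' i n hin
    dsimp only
    simp only [ht]
    rw [List.getElem_append_right hn]
    exact ht' _ (List.getElem_mem _)

end GraphEnd

/-! ### Disjoint rays through nested separators. -/

namespace GraphEnd

variable {V : Type u} {G : SimpleGraph V}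

/-- Pairwise disjoint finite paths indexed by `S₁` which meet the set `S` and the component at `S`
exactly in their last vertex, which is in `S`. -/
structure Ray.IsFan (R : Ray G) (S₁ S : Set V) (L : V → List V) : Prop where
  chain : ∀ s ∈ S₁, (L s).IsChain G.Adj
  nodup : ∀ s ∈ S₁, (L s).Nodup
  finish : ∀ s ∈ S₁, ∃ l, ∃ z ∈ S, L s = l ++ [z] ∧ ∀ x ∈ l, x ∉ S ∪ R.component S
  disjoint : ∀ s ∈ S₁, ∀ s' ∈ S₁, s ≠ s' → ∀ x ∈ L s, x ∉ L s'

/-- The old paths meet `S ∪ R.component S` only in their last vertices, and the linking stays inside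
this set, so gluing creates no new intersections. The default value of `getLastD` plays no role,
since the lists are nonempty. -/
theorem Ray.IsFan.extend {R : Ray G} {S₁ S S' : Set V} {L p : V → List V}
    (hL : R.IsFan S₁ S L) (hp : R.IsLinking S S' p) (hS : S' ∪ R.component S' ⊆ R.component S) :
    R.IsFan S₁ S' (fun s => (L s).dropLast ++ p ((L s).getLastD s)) ∧
    ∀ s ∈ S₁, ∃ t, t ≠ [] ∧ (L s).dropLast ++ p ((L s).getLastD s) = L s ++ t ∧
      ∀ x ∈ t, x ∈ R.component S := by
  have key : ∀ s ∈ S₁, ∃ l, ∃ z ∈ S, L s = l ++ [z] ∧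
      (L s).dropLast ++ p ((L s).getLastD s) = l ++ p z ∧ ∀ x ∈ l, x ∉ S ∪ R.component S := by
    intro s hs
    obtain ⟨l, z, hz, e, hl⟩ := hL.finish s hs
    exact ⟨l, z, hz, e, by rw [e]; simp, hl⟩
  have hpK : ∀ z ∈ S, ∀ x ∈ p z, x ∈ S ∪ R.component S := by
    intro z hz x hx
    obtain ⟨t, ht, ht'⟩ := hp.start z hz
    rw [ht] at hx
    rcases List.mem_cons.1 hx with rfl | hx
    exacts [Or.inl hz, Or.inr (ht' x hx)]
  refine ⟨⟨?_, ?_, ?_, ?_⟩, ?_⟩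
  · intro s hs
    obtain ⟨l, z, hz, e, e', hl⟩ := key s hs
    obtain ⟨t, ht, -⟩ := hp.start z hz
    have h1 := hL.chain s hs
    have h2 := hp.chain z hz
    rw [e] at h1
    rw [ht] at h2
    simp only [e', ht]
    exact List.isChain_split.2 ⟨h1, h2⟩
  · intro s hs
    obtain ⟨l, z, hz, e, e', hl⟩ := key s hs
    have h1 := hL.nodup s hs
    rw [e] at h1
    simp only [e']
    rw [List.nodup_append]
    refine ⟨h1.of_append_left, hp.nodup z hz, ?_⟩
    rintro x hx y hy rfl
    exact hl x hx (hpK z hz x hy)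
  · intro s hs
    obtain ⟨l, z, hz, e, e', hl⟩ := key s hs
    obtain ⟨l', z', hz', e₂, hl'⟩ := hp.finish z hz
    refine ⟨l ++ l', z', hz', by simp only [e', e₂, List.append_assoc], fun x hx => ?_⟩
    rcases List.mem_append.1 hx with hx | hx
    · exact fun h => hl x hx (Or.inr (hS h))
    · exact hl' x hx
  · intro s hs s' hs' hne x hx hx'
    obtain ⟨l, z, hz, e, e', hl⟩ := key s hs
    obtain ⟨l₂, z₂, hz₂, e₂, e₂', hl₂⟩ := key s' hs'
    have hd := hL.disjoint s hs s' hs' hne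
    rw [e, e₂] at hd
    simp only [e', e₂', List.mem_append] at hx hx'
    rcases hx with hx | hx <;> rcases hx' with hx' | hx'
    · exact hd x (by simp [hx]) (by simp [hx'])
    · exact hl x hx (hpK _ hz₂ x hx')
    · exact hl₂ x hx' (hpK _ hz x hx)
    · refine hp.disjoint z hz z₂ hz₂ ?_ x hx hx'
      rintro rfl
      exact hd z (by simp) (by simp)
  · intro s hs
    obtain ⟨l, z, hz, e, e', hl⟩ := key s hs
    obtain ⟨t, ht, ht'⟩ := hp.start z hz
    refine ⟨t, ?_, by rw [e', ht, e]; simp, ht'⟩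
    rintro rfl
    obtain ⟨l', z', hz', e₂, -⟩ := hp.finish z hz
    rw [ht] at e₂
    have : z = z' := by
      have := congrArg List.getLast? e₂
      simpa using this
    subst this
    exact notMem_of_mem_component (hS (Or.inl hz')) hz

/-- A vertex joined by a walk to the first of a sequence of nested separators is eventually
outside of the components at these separators. -/
theorem Ray.notMem_component_of_walk {R : Ray G} (S : ℕ → Set V)
    (hS : ∀ i, S (i + 1) ∪ R.component (S (i + 1)) ⊆ R.component (S i)) {v s : V}
    (p : G.Walk v s) (hs : s ∈ S 0) : v ∉ S (p.length + 1) ∪ R.component (S (p.length + 1)) := by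
  induction p with
  | nil => exact fun h => notMem_of_mem_component (hS 0 h) hs
  | @cons _ w _ h p ih =>
    intro hv
    have hv' := hS _ hv
    simp only [SimpleGraph.Walk.length_cons] at hv'
    refine ih hs ?_
    by_cases hw : w ∈ S (p.length + 1)
    · exact Or.inl hw
    · exact Or.inr (mem_component_of_adj hv' hw h)

/-- If the end of `R` is undominated, then every finite set `Y` of vertices can be separated from it
by a set disjoint from `Y` whose size is at most the degree of the end. -/
theorem Ray.exists_separates_card_le_deg (R : Ray G)
    (hdom : ∀ v, ¬ Dominates v (Quotient.mk (raySetoid G) R : Ends G)) (Y : Finset V) :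
    ∃ S : Finset V, R.Separates Y S ∧
      (S.card : ℕ∞) ≤ deg (Quotient.mk (raySetoid G) R : Ends G) := by
  classical
  choose next hnext using fun Y : Finset V => R.exists_isMinSeparator Y fun y _ => hdom y
  -- The shift by one makes `S 0` a minimum separator of `Y`, not `Y` itself.
  let S : ℕ → Finset V := fun i => next^[i + 1] Y
  have hS₀ : R.IsMinSeparator Y (S 0) := hnext Y
  have hS : ∀ i, R.IsMinSeparator (S i) (S (i + 1)) := by
    intro i
    simp only [S]
    rw [Function.iterate_succ_apply' next (i + 1)]
    exact hnext _
  have hnest : ∀ i, (S (i + 1) : Set V) ∪ R.component (S (i + 1)) ⊆ R.component (S i) := fun i =>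
    (hS i).separates.subset_component (hS i).subset
  have hlink : ∀ i, ∃ p, R.IsLinking (S i) (S (i + 1)) p := by
    intro i
    cases i with
    | zero => exact hS₀.exists_isLinking (hS 0)
    | succ i => exact (hS i).exists_isLinking (hS (i + 1))
  choose p hp using hlink
  let L : ℕ → V → List V := fun i => i.rec (fun s => [s])
    (fun i L s => (L s).dropLast ++ p i ((L s).getLastD s))
  have hfan : ∀ i, R.IsFan (S 0) (S i) (L i) := by
    intro i
    induction i with
    | zero =>
      refine ⟨by simp [L], by simp [L], fun s hs => ⟨[], s, hs, rfl, by simp⟩, ?_⟩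
      intro s _ s' _ hne x hx hx'
      exact hne ((List.mem_singleton.1 hx).symm.trans (List.mem_singleton.1 hx'))
    | succ i ih => exact (ih.extend (hp i) (hnest i)).1
  have hext : ∀ i, ∀ s ∈ S 0, ∃ t, t ≠ [] ∧ L (i + 1) s = L i s ++ t ∧
      ∀ x ∈ t, x ∈ R.component (S i) := fun i =>
    ((hfan i).extend (hp i) (hnest i)).2
  have hanti : Antitone fun i => R.component (S i) :=
    antitone_nat_of_succ_le fun i => Set.subset_union_right.trans (hnest i)
  have hray : ∀ s : S 0, ∃ R' : Ray G, (∀ n i, n ≤ i → R'.vert n ∈ L i s) ∧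
      ∀ i, R'.HasTailIn (R.component (S i)) := by
    rintro ⟨s, hs⟩
    refine exists_ray_of_lists (fun i => L i s) _ hanti ?_ ?_ (fun i => (hfan i).chain s hs)
      (fun i => (hfan i).nodup s hs)
    · intro i
      obtain ⟨t, -, h⟩ := hext i s hs
      exact ⟨t, h⟩
    · intro i
      induction i with
      | zero => simp [L]
      | succ i ih =>
        obtain ⟨t, ht, e, -⟩ := hext i s hs
        have := List.length_pos_iff.2 ht
        rw [e, List.length_append]
        omega
  choose R' hR' hR'tail using hray
  have hdisj : ∀ s s' : S 0, s ≠ s' → Disjoint (R' s).verts (R' s').verts := by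
    intro s s' hne
    rw [Set.disjoint_left]
    rintro _ ⟨n, rfl⟩ ⟨m, hm⟩
    refine (hfan (max n m)).disjoint s s.2 s' s'.2 (fun h => hne (Subtype.ext h)) _
      (hR' s n _ (le_max_left _ _)) ?_
    rw [← hm]
    exact hR' s' m _ (le_max_right _ _)
  have hinj : Function.Injective R' := by
    intro s s' h
    by_contra hne
    have := hdisj s s' hne
    rw [h, disjoint_self] at this
    exact (Set.range_nonempty (R' s').vert).ne_empty this
  refine ⟨S 0, hS₀.separates, le_sSup ⟨Set.range R', ?_, ?_, ?_⟩⟩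
  · rintro _ ⟨s, rfl⟩
    rw [Ray.belongsTo_mk_iff, Ray.equivalent_iff]
    intro T hT
    -- The components at the separators shrink to nothing: a vertex in all of them would be joined
    -- to `S 0` by a walk, and each edge of a walk passes at most one level of the nested sequence.
    -- Hence any finite `T` is left behind.
    have hev : ∀ v, ∃ j, v ∉ R.component (S j) := by
      intro v
      by_contra hc
      push Not at hc
      obtain ⟨N, hN⟩ := hS₀.subset s.2
      obtain ⟨M, hM⟩ := hc 0
      obtain ⟨q, -⟩ := hN (max N M) (le_max_left _ _)
      obtain ⟨q', -⟩ := hM (max N M) (le_max_right _ _)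
      exact Ray.notMem_component_of_walk (fun i => (S i : Set V)) hnest (q'.append q.reverse) s.2
        (Or.inr (hc _))
    choose j hj using hev
    obtain ⟨J, hJ⟩ := (hT.image j).bddAbove
    refine Ray.hasTailIn_mono (Ray.component_subset fun x hx hx' => ?_) (hR'tail s J)
    exact hj x (hanti (hJ ⟨x, hx, rfl⟩) hx')
  · rintro _ ⟨s, rfl⟩ _ ⟨s', rfl⟩ hne
    exact hdisj s s' fun h => hne (congrArg R' h)
  · rw [← Set.image_univ, hinj.encard_image, Set.encard_univ]
    simp

end GraphEnd

/-! ### Passing to a subgraph that isolates the dominating vertices. -/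

namespace GraphEnd

variable {V : Type u} {G H : SimpleGraph V}

/-- A ray of a spanning subgraph, as a ray of the whole graph. -/
def Ray.mapLe (h : H ≤ G) (R : Ray H) : Ray G := ⟨R.vert, R.injective, fun n => h (R.adj n)⟩

theorem Ray.component_mapLe (h : H ≤ G) (R : Ray H) (T : Set V) :
    R.component T ⊆ (R.mapLe h).component T := by
  rintro v ⟨N, hN⟩
  refine ⟨N, fun n hn => ?_⟩
  obtain ⟨p, hp⟩ := hN n hn
  refine ⟨p.mapLe h, fun x hx => hp x ?_⟩
  change x ∈ (p.mapLe h).support at hx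
  simpa using hx

theorem Ray.Equivalent.mapLe (h : H ≤ G) {R R' : Ray H} (hR : R.Equivalent R') :
    (R.mapLe h).Equivalent (R'.mapLe h) := by
  rw [Ray.equivalent_iff] at hR ⊢
  exact fun T hT => Ray.hasTailIn_mono (Ray.component_mapLe h R T) (hR T hT)

theorem Dominates.mapLe (h : H ≤ G) {R : Ray H} {v : V}
    (hv : Dominates v (Quotient.mk (raySetoid H) R : Ends H)) :
    Dominates v (Quotient.mk (raySetoid G) (R.mapLe h) : Ends G) := by
  obtain ⟨R', hR', w, P, hw, hP⟩ := hv
  refine ⟨R'.mapLe h, ?_, w, fun i => ⟨(P i).1.mapLe h, (P i).2.mapLe h⟩, hw, ?_⟩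
  · rw [Ray.belongsTo_mk_iff] at hR' ⊢
    exact hR'.mapLe h
  · intro i j hij x hx hx'
    exact hP i j hij x (by simpa using hx) (by simpa using hx')

theorem Ray.mapLe_injective (h : H ≤ G) : Function.Injective (Ray.mapLe h) := by
  rintro ⟨v, _, _⟩ ⟨v', _, _⟩ e
  simp only [Ray.mapLe, Ray.mk.injEq] at e
  simpa using e

theorem deg_le_deg_mapLe (h : H ≤ G) (R : Ray H) :
    deg (Quotient.mk (raySetoid H) R : Ends H) ≤
      deg (Quotient.mk (raySetoid G) (R.mapLe h) : Ends G) := by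
  refine sSup_le ?_
  rintro _ ⟨F, hF, hd, rfl⟩
  refine le_sSup ⟨Ray.mapLe h '' F, ?_, ?_, ((Ray.mapLe_injective h).encard_image F).symm⟩
  · rintro _ ⟨R', hR', rfl⟩
    have := hF R' hR'
    rw [Ray.belongsTo_mk_iff] at this ⊢
    exact this.mapLe h
  · rintro _ ⟨R₁, hR₁, rfl⟩ _ ⟨R₂, hR₂, rfl⟩ hne
    exact hd hR₁ hR₂ fun e => hne (congrArg _ e)

theorem edgesInside_le (G : SimpleGraph V) (K : Set V) : edgesInside G K ≤ G := fun _ _ h => h.1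

/-- A vertex incident with no edge dominates no end. -/
theorem Dominates.exists_adj {v : V} {ω : Ends G} (h : Dominates v ω) : ∃ u, G.Adj v u := by
  obtain ⟨R, hR, w, P, hw, hP⟩ := h
  have hne := (hw 0).2
  obtain ⟨p, -⟩ := P 0
  generalize w 0 = x at p hne
  cases p with
  | nil => exact absurd rfl hne
  | cons h _ => exact ⟨_, h⟩

/-- After deleting the dominating vertices of an end, if these are finite in number, some ray of the
end belongs to an undominated end. -/
theorem exists_undominated_ray (ω : Ends G) {D : Set V} (hD : D.Finite)
    (hdom : ∀ v, Dominates v ω → v ∈ D) :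
    ∃ R : Ray (edgesInside G Dᶜ),
      (R.mapLe (edgesInside_le G _)).BelongsTo ω ∧
      ∀ v, ¬ Dominates v (Quotient.mk (raySetoid _) R : Ends _) := by
  obtain ⟨R₀, rfl⟩ := Quotient.exists_rep ω
  obtain ⟨N, hN⟩ := R₀.eventually_notMem hD
  let R : Ray (edgesInside G Dᶜ) :=
    ⟨fun n => R₀.vert (N + n), fun a b h => by simpa using R₀.injective h, fun n =>
      ⟨R₀.adj (N + n), hN _ (by omega), hN _ (by omega)⟩⟩
  have hR : (R.mapLe (edgesInside_le G _)).BelongsTo (Quotient.mk (raySetoid G) R₀ : Ends G) := by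
    rw [Ray.belongsTo_mk_iff, Ray.equivalent_iff]
    intro T hT
    obtain ⟨M, hM⟩ := R₀.hasTailIn_component hT
    exact ⟨M, fun n hn => hM (N + n) (by omega)⟩
  refine ⟨R, hR, fun v hv => ?_⟩
  -- A dominating vertex of the subgraph has an edge there, so it is outside `D`; but it also
  -- dominates `ω` in `G`, so it is in `D`.
  obtain ⟨u, hu⟩ := hv.exists_adj
  have := hv.mapLe (edgesInside_le G _)
  rw [hR] at this
  exact hu.2.1 (hdom v this)

/-! ### How separations are oriented by rays and dominating vertices. -/

namespace FinSep

/-- The separation with its sides exchanged. -/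
def swap (s : FinSep G) : FinSep G where
  left := s.right
  right := s.left
  isSeparation := by
    refine ⟨by rw [Set.union_comm]; exact s.isSeparation.1, fun a ha b hb h => ?_⟩
    exact s.isSeparation.2 b hb a ha h.symm
  finite := by rw [Set.inter_comm]; exact s.finite

theorem mem_right_of_notMem_left (s : FinSep G) {v : V} (h : v ∉ s.left) : v ∈ s.right := by
  have : v ∈ s.left ∪ s.right := by rw [s.isSeparation.1]; trivial
  exact this.resolve_left h

theorem mem_right_of_walk (s : FinSep G) {u v : V} (p : G.Walk u v) (hv : v ∈ s.right)
    (hp : ∀ x ∈ p.support, x ∉ s.left ∩ s.right) : u ∈ s.right := by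
  induction p with
  | nil => exact hv
  | @cons u w v h p ih =>
    have hw := ih hv fun x hx => hp x (by simp [hx])
    by_contra hu
    have hul : u ∈ s.left := s.swap.mem_right_of_notMem_left hu
    exact s.isSeparation.2 u ⟨hul, hu⟩ w ⟨hw, fun hwl => hp w (by simp) ⟨hwl, hw⟩⟩ h

theorem hasTailIn_right_of_equivalent (s : FinSep G) {R R' : Ray G} (h : R.Equivalent R')
    (hR : R.HasTailIn s.right) : R'.HasTailIn s.right := by
  obtain ⟨M, hM⟩ := hR
  refine Ray.hasTailIn_mono ?_ (Ray.equivalent_iff.1 h _ s.finite)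
  rintro v ⟨N, hN⟩
  obtain ⟨p, hp⟩ := hN (max N M) (le_max_left _ _)
  exact s.mem_right_of_walk p (hM _ (le_max_right _ _)) hp

/-- A single ray decides: equivalent rays have tails in the same component of `G` minus the finite
separator, and no component meets both sides. -/
theorem mem_endTangle_of_ray (s : FinSep G) {ω : Ends G} {R : Ray G} (hR : R.BelongsTo ω)
    (h : R.HasTailIn s.right) : s ∈ endTangle ω := by
  obtain rfl := hR
  exact fun R' hR' => s.hasTailIn_right_of_equivalent (Ray.belongsTo_mk_iff.1 hR') h

theorem hasTailIn_left_or_right (s : FinSep G) (R : Ray G) :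
    R.HasTailIn s.left ∨ R.HasTailIn s.right := by
  obtain ⟨N, hN⟩ := R.eventually_notMem s.finite
  have key : ∀ n, N ≤ n → ∃ p : G.Walk (R.vert n) (R.vert N), ∀ x ∈ p.support,
      x ∉ s.left ∩ s.right := by
    intro n hn
    obtain ⟨p, hp⟩ := R.exists_walk hn
    refine ⟨p.reverse, fun x hx => ?_⟩
    rw [SimpleGraph.Walk.support_reverse, List.mem_reverse] at hx
    obtain ⟨i, hi, rfl⟩ := hp x hx
    exact hN i hi
  by_cases h : R.vert N ∈ s.left
  · refine Or.inl ⟨N, fun n hn => ?_⟩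
    obtain ⟨p, hp⟩ := key n hn
    exact s.swap.mem_right_of_walk p h fun x hx h => hp x hx ⟨h.2, h.1⟩
  · refine Or.inr ⟨N, fun n hn => ?_⟩
    obtain ⟨p, hp⟩ := key n hn
    exact s.mem_right_of_walk p (s.mem_right_of_notMem_left h) hp

theorem swap_mem_endTangle (s : FinSep G) {ω : Ends G} (h : s ∉ endTangle ω) :
    s.swap ∈ endTangle ω := by
  obtain ⟨R, rfl⟩ := Quotient.exists_rep ω
  refine s.swap.mem_endTangle_of_ray (R := R) rfl ?_
  exact (s.hasTailIn_left_or_right R).resolve_right fun h' => h (s.mem_endTangle_of_ray rfl h')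

theorem eventually_notMem_right (s : FinSep G) {ω : Ends G} (h : s ∉ endTangle ω) {R : Ray G}
    (hR : R.BelongsTo ω) : ∃ N, ∀ n, N ≤ n → R.vert n ∉ s.right := by
  obtain ⟨N, hN⟩ := s.swap_mem_endTangle h R hR
  obtain ⟨M, hM⟩ := R.eventually_notMem s.finite
  exact ⟨max N M, fun n hn h => hM n (by omega) ⟨hN n (by omega), h⟩⟩

end FinSep

/-- Otherwise all but finitely many paths of the fan at `v` end in the right side and so cross the
separator. They share only `v`, which is not in the separator, so the separator would be infinite.
-/
theorem Dominates.mem_right {v : V} {ω : Ends G} (hv : Dominates v ω) {s : FinSep G}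
    (hs : s ∈ endTangle ω) : v ∈ s.right := by
  by_contra hvr
  obtain ⟨R, hR, w, P, hw, hP⟩ := hv
  obtain ⟨N, hN⟩ := hs R hR
  have hwinj : Function.Injective w := by
    intro i j hij
    by_contra hne
    exact (hw i).2 (hP i j hne (w i) (P i).1.end_mem_support
      (by rw [hij]; exact (P j).1.end_mem_support))
  have hfin : {i | w i ∈ R.vert '' Set.Iio N}.Finite :=
    ((Set.finite_Iio N).image R.vert).preimage hwinj.injOn
  have hx : ∀ i ∈ {i | w i ∈ R.vert '' Set.Iio N}ᶜ,
      ∃ x ∈ (P i).1.support, x ∈ s.left ∩ s.right := by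
    intro i hi
    by_contra hc
    push Not at hc
    refine hvr (s.mem_right_of_walk (P i).1 ?_ hc)
    obtain ⟨n, hn⟩ := (hw i).1
    rw [← hn]
    refine hN n (not_lt.1 fun hlt => hi ⟨n, hlt, hn⟩)
  have : Nonempty V := ⟨v⟩
  choose! x hxP hxs using hx
  refine Set.infinite_of_injOn_mapsTo ?_ hxs hfin.infinite_compl s.finite
  intro i hi j hj hij
  by_contra hne
  have := hP i j hne (x i) (hxP i hi) (hij ▸ hxP j hj)
  exact hvr (this ▸ (hxs i hi).2)

/-- If `ω` has only finitely many dominating vertices, then the separation of `G` into `V` and the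
set of these vertices is a limit of separations of small order in the tangle of `ω`. -/
theorem exists_mem_endTangle_near (ω : Ends G) (hD : {v | Dominates v ω}.Finite) {Z : Set V}
    (hZ : Z.Finite) :
    ∃ s ∈ endTangle ω, Z ⊆ s.left ∧ s.right ∩ Z = {v | Dominates v ω} ∩ Z ∧
      (s.left ∩ s.right).encard ≤ deg ω + dom ω := by
  classical
  have hdom : {v | Dominates v ω}.encard = dom ω := rfl
  have hmem : ∀ v, Dominates v ω → v ∈ {v | Dominates v ω} := fun v hv => hv
  generalize {v | Dominates v ω} = D at hD hdom hmem ⊢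
  obtain ⟨R, hR, hund⟩ := exists_undominated_ray ω hD hmem
  -- Including `D` in the separated set keeps it out of the component; `D` then has to join `S` in
  -- the separator, since its edges were deleted when `S` was found.
  obtain ⟨S, hS, hcard⟩ := R.exists_separates_card_le_deg hund (hZ.union hD).toFinset
  simp only [Set.Finite.coe_toFinset] at hS
  have hZC : ∀ z ∈ Z, z ∉ R.component S := fun z hz =>
    Set.disjoint_left.1 hS.disjoint_component (Or.inl hz)
  have hDC : ∀ z ∈ D, z ∉ R.component S := fun z hz =>
    Set.disjoint_left.1 hS.disjoint_component (Or.inr hz)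
  have hinter : (R.component S)ᶜ ∩ ((S : Set V) ∪ D ∪ R.component S) = (S : Set V) ∪ D := by
    ext x
    constructor
    · rintro ⟨h1, h2 | h2⟩
      exacts [h2, absurd h2 h1]
    · intro h
      refine ⟨?_, Or.inl h⟩
      rcases h with h | h
      exacts [fun h' => Ray.notMem_of_mem_component h' h, hDC x h]
  let s : FinSep G :=
    { left := (R.component S)ᶜ
      right := (S : Set V) ∪ D ∪ R.component S
      isSeparation := by
        refine ⟨?_, ?_⟩
        · ext x
          simp only [Set.mem_union, Set.mem_compl_iff, Set.mem_univ, iff_true]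
          tauto
        · rintro a ⟨ha, ha'⟩ b ⟨hb, hb'⟩ hab
          have hbC : b ∈ R.component S := not_not.1 hb'
          refine ha (Ray.mem_component_of_adj hbC (fun h => ha' (Or.inl (Or.inl h)))
            ⟨hab.symm, fun h => hDC b h hbC, fun h => ha' (Or.inl (Or.inr h))⟩)
      finite := by
        rw [hinter]
        exact S.finite_toSet.union hD }
  refine ⟨s, s.mem_endTangle_of_ray hR ?_, hZC, ?_, ?_⟩
  · exact Ray.hasTailIn_mono Set.subset_union_right (R.hasTailIn_component S.finite_toSet)
  · ext x
    constructor
    · rintro ⟨(h | h) | h, hx⟩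
      · exact absurd h (Set.disjoint_left.1 hS.disjoint (Or.inl hx))
      · exact ⟨h, hx⟩
      · exact absurd h (hZC x hx)
    · rintro ⟨h, hx⟩
      exact ⟨Or.inl (Or.inr h), hx⟩
  · change ((R.component S)ᶜ ∩ ((S : Set V) ∪ D ∪ R.component S)).encard ≤ _
    rw [hinter]
    refine (Set.encard_union_le _ _).trans (add_le_add ?_ hdom.le)
    rw [Set.encard_coe_eq_coe_finsetCard]
    refine hcard.trans ((deg_le_deg_mapLe (edgesInside_le G _) R).trans ?_)
    rw [hR]

end GraphEnd

/-! ### The topology, and when the restricted tangles are closed. -/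

namespace GraphEnd

variable {V : Type u} {G : SimpleGraph V}

/-- The generating sets already form a basis: two finite restrictions are both determined by the
restriction to the union of their test sets. -/
theorem exists_finite_basicOpen_subset {U : Set (FinSep G)} (hU : IsOpen U) {s : FinSep G}
    (hs : s ∈ U) :
    ∃ Z : Set V, Z.Finite ∧ basicOpen G Z (s.left ∩ Z) (s.right ∩ Z) ⊆ U := by
  induction hU with
  | basic O hO =>
    obtain ⟨Z, A', B', hZ, -, rfl⟩ := hO
    obtain ⟨rfl, rfl⟩ := hs
    exact ⟨Z, hZ, subset_rfl⟩
  | univ => exact ⟨∅, Set.finite_empty, Set.subset_univ _⟩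
  | inter O₁ O₂ _ _ ih₁ ih₂ =>
    obtain ⟨Z₁, hZ₁, h₁⟩ := ih₁ hs.1
    obtain ⟨Z₂, hZ₂, h₂⟩ := ih₂ hs.2
    refine ⟨Z₁ ∪ Z₂, hZ₁.union hZ₂, fun s' hs' => ⟨h₁ ?_, h₂ ?_⟩⟩
    · have e : ∀ A : Set V, A ∩ (Z₁ ∪ Z₂) ∩ Z₁ = A ∩ Z₁ := fun A => by
        rw [Set.inter_assoc, Set.union_inter_cancel_left]
      exact ⟨by rw [← e, hs'.1, e], by rw [← e, hs'.2, e]⟩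
    · have e : ∀ A : Set V, A ∩ (Z₁ ∪ Z₂) ∩ Z₂ = A ∩ Z₂ := fun A => by
        rw [Set.inter_assoc, Set.union_inter_cancel_right]
      exact ⟨by rw [← e, hs'.1, e], by rw [← e, hs'.2, e]⟩
  | sUnion 𝒪 _ ih =>
    obtain ⟨O, hO, hsO⟩ := hs
    obtain ⟨Z, hZ, h⟩ := ih O hO hsO
    exact ⟨Z, hZ, h.trans (Set.subset_sUnion_of_mem hO)⟩

theorem isOpen_basicOpen (s : FinSep G) {Z : Set V} (hZ : Z.Finite) :
    IsOpen (basicOpen G Z (s.left ∩ Z) (s.right ∩ Z)) := by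
  refine TopologicalSpace.isOpen_generateFrom_of_mem ⟨Z, _, _, hZ, ⟨?_, ?_⟩, rfl⟩
  · rw [← Set.union_inter_distrib_right, s.isSeparation.1, Set.univ_inter]
  · rintro a ⟨ha, ha'⟩ b ⟨hb, hb'⟩
    exact s.isSeparation.2 a ⟨ha.1, fun h => ha' ⟨h, ha.2⟩⟩ b ⟨hb.1, fun h => hb' ⟨h, hb.2⟩⟩

/-- A set of separations is closed if and only if every separation outside of it has a finite
restriction which no separation in the set has. -/
theorem isClosed_iff {F : Set (FinSep G)} :
    IsClosed F ↔ ∀ s ∉ F, ∃ Z : Set V, Z.Finite ∧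
      ∀ s' : FinSep G, s'.left ∩ Z = s.left ∩ Z → s'.right ∩ Z = s.right ∩ Z → s' ∉ F := by
  constructor
  · intro h s hs
    obtain ⟨Z, hZ, hsub⟩ := exists_finite_basicOpen_subset h.isOpen_compl hs
    exact ⟨Z, hZ, fun s' h₁ h₂ => hsub ⟨h₁, h₂⟩⟩
  · intro h
    rw [← isOpen_compl_iff, isOpen_iff_forall_mem_open]
    intro s hs
    obtain ⟨Z, hZ, hZ'⟩ := h s hs
    exact ⟨_, fun s' hs' => hZ' s' hs'.1 hs'.2, isOpen_basicOpen s hZ, rfl, rfl⟩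

theorem mem_iff_of_inter_eq {A B Z : Set V} (h : A ∩ Z = B ∩ Z) {v : V} (hv : v ∈ Z) :
    v ∈ A ↔ v ∈ B :=
  ⟨fun hA => ((Set.ext_iff.1 h v).1 ⟨hA, hv⟩).1, fun hB => ((Set.ext_iff.1 h v).2 ⟨hB, hv⟩).1⟩

theorem mem_sepsBelow_natCast {s : FinSep G} {k : ℕ} :
    s ∈ sepsBelow G k ↔ (s.left ∩ s.right).encard < k := by
  rw [← Set.toENat_cardinalMk, Cardinal.toENat_lt_natCast]
  rfl

/-- The separator of `s` serves as test set: a separation agreeing with `s` there has at least as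
large a separator. -/
theorem isClosed_sepsBelow (G : SimpleGraph V) (κ : Cardinal.{u}) : IsClosed (sepsBelow G κ) := by
  rw [isClosed_iff]
  intro s hs
  refine ⟨s.left ∩ s.right, s.finite, fun s' h₁ h₂ hs' => hs ?_⟩
  refine (Cardinal.mk_le_mk_of_subset ?_).trans_lt hs'
  exact fun v hv => ⟨(mem_iff_of_inter_eq h₁ hv).2 hv.1, (mem_iff_of_inter_eq h₂ hv).2 hv.2⟩

theorem isClosed_endTangle_of_dom_eq_top {ω : Ends G} (h : dom ω = ⊤) :
    IsClosed (endTangle ω) := by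
  rw [isClosed_iff]
  intro s hs
  have hinf : {v | Dominates v ω}.Infinite := Set.encard_eq_top_iff.1 h
  obtain ⟨v, hv, hvs⟩ := hinf.exists_notMem_finite s.finite
  refine ⟨{v}, Set.finite_singleton v, fun s' _ h₂ hs' => hvs ⟨?_, ?_⟩⟩
  · exact Dominates.mem_right hv (s.swap_mem_endTangle hs)
  · exact (mem_iff_of_inter_eq h₂ rfl).1 (Dominates.mem_right hv hs')

/-- A finite value below the supremum is attained: some family has more than `r - 1` members and can
be trimmed. -/
theorem exists_rays_of_le_deg {ω : Ends G} {r : ℕ} (h : (r : ℕ∞) ≤ deg ω) :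
    ∃ F : Set (Ray G), (∀ R ∈ F, R.BelongsTo ω) ∧ F.PairwiseDisjoint Ray.verts ∧
      F.encard = r := by
  cases r with
  | zero => exact ⟨∅, by simp, by simp, by simp⟩
  | succ r =>
    have hlt : (r : ℕ∞) < deg ω := lt_of_lt_of_le (by exact_mod_cast Nat.lt_succ_self r) h
    obtain ⟨_, ⟨F, hF, hd, rfl⟩, hr⟩ := lt_sSup_iff.1 hlt
    obtain ⟨F', hF', hc⟩ := Set.exists_subset_encard_eq (k := ((r + 1 : ℕ) : ℕ∞)) (s := F)
      (by rw [Nat.cast_add, Nat.cast_one]; exact Order.add_one_le_of_lt hr)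
    exact ⟨F', fun R hR => hF R (hF' hR), hd.subset hF', hc⟩

theorem exists_add_eq_of_le_add {a b : ℕ∞} {k : ℕ} (h : (k : ℕ∞) ≤ a + b) :
    ∃ r d : ℕ, (r : ℕ∞) ≤ a ∧ (d : ℕ∞) ≤ b ∧ r + d = k := by
  by_cases hb : (k : ℕ∞) ≤ b
  · exact ⟨0, k, by simp, hb, by simp⟩
  · push Not at hb
    lift b to ℕ using (hb.trans_le le_top).ne
    have hbk : b < k := by exact_mod_cast hb
    refine ⟨k - b, b, ?_, le_rfl, by omega⟩
    rw [ENat.natCast_sub]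
    exact tsub_le_iff_right.2 h

theorem isClosed_endTangle_inter_sepsBelow {ω : Ends G} {k : ℕ} (h : (k : ℕ∞) ≤ deg ω + dom ω) :
    IsClosed (endTangle ω ∩ sepsBelow G k) := by
  classical
  obtain ⟨r, d, hr, hd, rfl⟩ := exists_add_eq_of_le_add h
  obtain ⟨F, hF, hFd, hFc⟩ := exists_rays_of_le_deg hr
  obtain ⟨D, hD, hDc⟩ := Set.exists_subset_encard_eq hd
  rw [isClosed_iff]
  intro s hs
  by_cases hsk : s ∈ sepsBelow G (r + d : ℕ)
  swap
  · obtain ⟨Z, hZ, hZ'⟩ := isClosed_iff.1 (isClosed_sepsBelow G (r + d : ℕ)) s hsk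
    exact ⟨Z, hZ, fun s' h₁ h₂ h' => hZ' s' h₁ h₂ h'.2⟩
  have hsτ : s ∉ endTangle ω := fun h => hs ⟨h, hsk⟩
  by_cases hDr : ∃ v ∈ D, v ∉ s.right
  · obtain ⟨v, hv, hvr⟩ := hDr
    refine ⟨{v}, Set.finite_singleton v, fun s' _ h₂ hs' => hvr ?_⟩
    exact (mem_iff_of_inter_eq h₂ rfl).1 (Dominates.mem_right (hD hv) hs'.1)
  push Not at hDr
  have hDl : ∀ v ∈ D, v ∈ s.left := fun v hv =>
    Dominates.mem_right (hD hv) (s.swap_mem_endTangle hsτ)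
  have hDfin : D.Finite := Set.finite_of_encard_eq_coe hDc
  have hFfin : F.Finite := Set.finite_of_encard_eq_coe hFc
  choose! N hN using fun R hR => s.eventually_notMem_right hsτ (hF R hR)
  -- From index `N R` on, the ray `R` stays out of `s.right`.
  refine ⟨D ∪ (fun R => R.vert (N R)) '' F, hDfin.union (hFfin.image _), ?_⟩
  rintro s' h₁ h₂ ⟨hsτ', hordk⟩
  -- The ray starts outside `s'.right` at a test vertex and ends up inside, so it meets the
  -- separator of `s'`. It does so outside `s.right`, hence not in `D`.
  have hcross : ∀ R ∈ F, ∃ v ∈ R.verts, v ∉ s.right ∧ v ∈ s'.left ∩ s'.right := by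
    intro R hR
    obtain ⟨M, hM⟩ := hsτ' R (hF R hR)
    obtain ⟨p, hp⟩ := R.exists_walk (le_max_left (N R) M)
    by_contra hc
    push Not at hc
    refine hN R hR (N R) le_rfl
      ((mem_iff_of_inter_eq h₂ (Or.inr ⟨R, hR, rfl⟩)).1
        (s'.mem_right_of_walk p (hM _ (le_max_right _ _)) fun x hx => ?_))
    obtain ⟨i, hi, rfl⟩ := hp x hx
    exact hc _ ⟨i, rfl⟩ (hN R hR i hi)
  have : Nonempty V := by
    obtain ⟨R, -⟩ := Quotient.exists_rep ω
    exact ⟨R.vert 0⟩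
  choose! x hxR hxr hxs using hcross
  have hinj : Set.InjOn x F := by
    intro R hR R' hR' e
    by_contra hne
    exact Set.disjoint_left.1 (hFd hR hR' hne) (hxR R hR) (e ▸ hxR R' hR')
  have hdisj : Disjoint (x '' F) D := by
    rw [Set.disjoint_left]
    rintro _ ⟨R, hR, rfl⟩ hxD
    exact hxr R hR (hDr _ hxD)
  have hsub : x '' F ∪ D ⊆ s'.left ∩ s'.right := by
    rintro v (⟨R, hR, rfl⟩ | hv)
    · exact hxs R hR
    · exact ⟨(mem_iff_of_inter_eq h₁ (Or.inl hv)).2 (hDl v hv),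
        (mem_iff_of_inter_eq h₂ (Or.inl hv)).2 (hDr v hv)⟩
  have hle := Set.encard_le_encard hsub
  rw [Set.encard_union_eq hdisj, hinj.encard_image, hFc, hDc] at hle
  rw [mem_sepsBelow_natCast, Nat.cast_add] at hordk
  exact absurd hle (not_le.2 hordk)

/-- The restrictions of the tangle of a finitely dominated end to separations of sufficiently large
order are not closed. -/
theorem not_isClosed_of_dom_ne_top {ω : Ends G} (h : dom ω ≠ ⊤) {P : Set (FinSep G)}
    (hP : ∀ s : FinSep G, (s.left ∩ s.right).encard ≤ deg ω + dom ω → s ∈ P) :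
    ¬ IsClosed (endTangle ω ∩ P) := by
  intro hcl
  have hD : {v | Dominates v ω}.Finite := Set.encard_ne_top_iff.1 h
  let s : FinSep G :=
    { left := Set.univ
      right := {v | Dominates v ω}
      isSeparation := ⟨by simp, fun a _ b hb => absurd trivial hb.2⟩
      finite := hD.subset Set.inter_subset_right }
  have hs : s ∉ endTangle ω := by
    intro hs
    obtain ⟨R, hR⟩ := Quotient.exists_rep ω
    obtain ⟨N, hN⟩ := hs R hR
    obtain ⟨M, hM⟩ := R.eventually_notMem hD
    exact hM _ (le_max_right N M) (hN _ (le_max_left N M))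
  obtain ⟨Z, hZ, hZ'⟩ := isClosed_iff.1 hcl s fun h => hs h.1
  obtain ⟨s', hs', hl, hr, hc⟩ := exists_mem_endTangle_near ω hD hZ
  refine hZ' s' ?_ hr ⟨hs', hP s' hc⟩
  change s'.left ∩ Z = Set.univ ∩ Z
  rw [Set.univ_inter, Set.inter_eq_right.2 hl]

theorem isClosed_endTangle_iff (ω : Ends G) : IsClosed (endTangle ω) ↔ dom ω = ⊤ := by
  refine ⟨fun h => ?_, isClosed_endTangle_of_dom_eq_top⟩
  by_contra hd
  refine not_isClosed_of_dom_ne_top hd (P := Set.univ) (fun _ _ => trivial) ?_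
  rwa [Set.inter_univ]

theorem isClosed_endTangle_inter_sepsBelow_iff (ω : Ends G) (k : ℕ) :
    IsClosed (endTangle ω ∩ sepsBelow G k) ↔ (k : ℕ∞) ≤ deg ω + dom ω := by
  refine ⟨fun h => ?_, isClosed_endTangle_inter_sepsBelow⟩
  by_contra hk
  push Not at hk
  refine not_isClosed_of_dom_ne_top ?_ (fun s hs => ?_) h
  · rintro e
    rw [e, add_top] at hk
    exact not_top_lt hk
  · exact mem_sepsBelow_natCast.2 (hs.trans_lt hk)

/-! ### Evaluating the cohesion. -/

theorem sepsBelow_aleph0 (G : SimpleGraph V) : sepsBelow G Cardinal.aleph0 = Set.univ :=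
  Set.eq_univ_of_forall fun s => Cardinal.mk_lt_aleph0_iff.2 s.finite

/-- Failure at `κ` itself excludes every larger cardinal from the supremum; at `ℵ₁` the cap in the
definition does this instead. -/
theorem coh_eq_of_isGreatest {ω : Ends G} {κ : Cardinal.{u}} (h : κ ≤ Cardinal.aleph 1)
    (h₁ : ∀ k < κ, IsClosed (endTangle ω ∩ sepsBelow G k))
    (h₂ : κ < Cardinal.aleph 1 → ¬ IsClosed (endTangle ω ∩ sepsBelow G κ)) : coh ω = κ := by
  refine IsGreatest.csSup_eq ⟨⟨h, h₁⟩, fun κ' hκ' => ?_⟩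
  by_contra hlt
  push Not at hlt
  exact h₂ (hlt.trans_le hκ'.1) (hκ'.2 κ hlt)

theorem aleph0_lt_aleph_one : (Cardinal.aleph0 : Cardinal.{u}) < Cardinal.aleph 1 := by
  rw [← Cardinal.aleph_zero]
  exact Cardinal.aleph_lt_aleph.2 zero_lt_one

theorem coh_eq_aleph_one {ω : Ends G} (h : dom ω = ⊤) : coh ω = Cardinal.aleph 1 := by
  refine coh_eq_of_isGreatest le_rfl (fun k _ => ?_) (fun h => absurd h (lt_irrefl _))
  exact (isClosed_endTangle_of_dom_eq_top h).inter (isClosed_sepsBelow G k)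

theorem coh_eq_aleph0 {ω : Ends G} (h : deg ω = ⊤) (h' : dom ω ≠ ⊤) :
    coh ω = Cardinal.aleph0 := by
  refine coh_eq_of_isGreatest aleph0_lt_aleph_one.le (fun k hk => ?_) (fun _ hc => ?_)
  · obtain ⟨n, rfl⟩ := Cardinal.lt_aleph0.1 hk
    rw [isClosed_endTangle_inter_sepsBelow_iff, h, top_add]
    exact le_top
  · rw [sepsBelow_aleph0, Set.inter_univ, isClosed_endTangle_iff] at hc
    exact h' hc

/-- The restrictions are closed up to `k = m` and fail at `m + 1`; the supremum quantifies over `k <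
κ`, hence the extra one. -/
theorem coh_eq_natCast {ω : Ends G} {m : ℕ} (h : deg ω + dom ω = m) :
    coh ω = (m + 1 : ℕ) := by
  refine coh_eq_of_isGreatest (Cardinal.natCast_lt_aleph0.trans aleph0_lt_aleph_one).le
    (fun k hk => ?_) (fun _ hc => ?_)
  · obtain ⟨n, rfl⟩ := Cardinal.lt_aleph0.1 (hk.trans Cardinal.natCast_lt_aleph0)
    rw [isClosed_endTangle_inter_sepsBelow_iff, h]
    have : n < m + 1 := by exact_mod_cast hk
    exact_mod_cast Nat.lt_succ_iff.1 this
  · rw [isClosed_endTangle_inter_sepsBelow_iff, h] at hc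
    have : m + 1 ≤ m := by exact_mod_cast hc
    omega

end GraphEnd

/-- Adding one on the left in (iii) avoids truncated subtraction, so that `k = 0` is correctly
excluded. -/
theorem mainTheorem2 {V : Type u} (G : SimpleGraph V) (ω : GraphEnd.Ends G) :
    -- (i) infinite cohesion, i.e. the end tangle is closed
    ((GraphEnd.HasInfiniteCohesion ω ↔ GraphEnd.dom ω = ⊤) ∧
      (IsClosed (GraphEnd.endTangle ω) ↔ GraphEnd.dom ω = ⊤)) ∧
    -- (ii) unbounded cohesion, i.e. the end tangle is not closed but all its restrictions are
    ((GraphEnd.HasUnboundedCohesion ω ↔ GraphEnd.deg ω = ⊤ ∧ GraphEnd.dom ω < ⊤) ∧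
      ((¬ IsClosed (GraphEnd.endTangle ω) ∧
          ∀ k : ℕ, IsClosed (GraphEnd.endTangle ω ∩ GraphEnd.sepsBelow G k)) ↔
        GraphEnd.deg ω = ⊤ ∧ GraphEnd.dom ω < ⊤)) ∧
    -- (iii) bounded cohesion `k`
    (∀ k : ℕ, GraphEnd.HasBoundedCohesion ω k ↔
      GraphEnd.deg ω + GraphEnd.dom ω + 1 = (k : ℕ∞)) := by
  have h01 := GraphEnd.aleph0_lt_aleph_one.{u}
  have hn0 : ∀ n : ℕ, (n : Cardinal.{u}) < Cardinal.aleph0 := fun n => Cardinal.natCast_lt_aleph0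
  simp only [GraphEnd.HasInfiniteCohesion, GraphEnd.HasUnboundedCohesion,
    GraphEnd.HasBoundedCohesion, GraphEnd.isClosed_endTangle_iff,
    GraphEnd.isClosed_endTangle_inter_sepsBelow_iff, lt_top_iff_ne_top]
  by_cases hdom : GraphEnd.dom ω = ⊤
  · have hcoh := GraphEnd.coh_eq_aleph_one hdom
    refine ⟨by simp [hcoh, hdom], by simp [hcoh, hdom, h01.ne'], fun k => ?_⟩
    simp [hcoh, hdom, ((hn0 k).trans h01).ne']
  by_cases hdeg : GraphEnd.deg ω = ⊤
  · have hcoh := GraphEnd.coh_eq_aleph0 hdeg hdom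
    refine ⟨by simp [hcoh, hdom, h01.ne], by simp [hcoh, hdom, hdeg], fun k => ?_⟩
    simp [hcoh, hdeg, (hn0 k).ne']
  · obtain ⟨m, hm⟩ : ∃ m : ℕ, GraphEnd.deg ω + GraphEnd.dom ω = m := by
      obtain ⟨a, ha⟩ := ENat.ne_top_iff_exists.1 hdeg
      obtain ⟨b, hb⟩ := ENat.ne_top_iff_exists.1 hdom
      exact ⟨a + b, by rw [← ha, ← hb, Nat.cast_add]⟩
    have hcoh := GraphEnd.coh_eq_natCast hm
    refine ⟨⟨?_, trivial⟩, ⟨?_, ?_⟩, fun k => ?_⟩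
    · simp only [hcoh, hdom, iff_false]
      exact ((hn0 _).trans h01).ne
    · simp only [hcoh, hdeg, false_and, iff_false]
      exact (hn0 _).ne
    · simp only [hdeg, false_and, iff_false, not_and, not_forall]
      refine fun _ => ⟨m + 1, fun h => ?_⟩
      rw [hm] at h
      have : m + 1 ≤ m := by exact_mod_cast h
      omega
    · rw [hcoh, hm]
      norm_cast
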